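/- **Setting.** Let $k\ge 2$, $M\ge1$, $T\ge1$ be integers and let $\mathcal X$ carry a $k$-ary hierarchical partition $(\mathcal P_{h,i})_{h\ge0,\,1\le i\le k^h}$: $\mathcal P_{0,1}=\mathcal X$, the cells of each depth are pairwise disjoint, $\mathcal P_{h,i}=\bigcup_{j=0}^{k-1}\mathcal P_{h+1,ki-j}$, and each cell has a fixed representative point $x_{h,i}\in\mathcal P_{h,i}$. Client $m\in\{1,\dots,M\}$ has a local objective $f_m$; if it pulls $x\in\mathcal X$ in a round, it receives a random reward in $[0,1]$ with mean $f_m(x)$, rewards of distinct clients or distinct rounds being independent. Put $f=\frac1M\sum_m f_m$ and $f^*=\sup_{\mathcal X}f$. **Assumptions.** There are $\nu_1>0$, $0<\rho<1$ and $\ell:\mathcal X^2\to[0,\infty)$ with $\ell(x,x)=0$ such that $\ell(x,y)\le\nu_1\rho^h$ whenever $x,y$ lie in a common cell of depth $h$, and $f^*-f(y)\le f^*-f(x)+\max\{f^*-f(x),\ell(x,y)\}$ for all $x,y\in\mathcal X$ (weak-Lipschitz local smoothness). Moreover $f$ has near-optimality dimension $d\ge0$ with constant $C>0$: for each $h\ge0$,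 at most $C\rho^{-dh}$ of the nodes $(h,i)$ of depth $h$ satisfy $f^*-f(x_{h,i})\le6\nu_1\rho^h$. **Algorithm (Fed-PNE)** with parameters $c\ge2$, $c_1\ge(2M)^{1/8}$, $\delta=1/M$. Put $\tau_h=\left\lceil \frac{c^2\log(c_1T/\delta)}{\nu_1^2}\rho^{-2h}\right\rceil$, $t_h=\lceil\tau_h/M\rceil$, $b_h=c\sqrt{\log(c_1T/\delta)/(Mt_h)}$. Start with $h=1$ and $\mathcal K$ the set of children of the root. In each phase: (i) while $|\mathcal K|\tau_h\le M$ or $\tau_h\le1$, replace $\mathcal K$ by the set of all children of its nodes and $h$ by $h+1$; (ii) every client pulls $x_{h,i}$ for the nodes $(h,i)\in\mathcal K$ in increasing order of $i$, $t_h$ times each; (iii) $\widehat\mu_{h,i}$ is the average over the clients of their mean rewards from node $(h,i)$ in this phase, and the nodes with $\widehat\mu_{h,i}+b_h+\nu_1\rho^h<\max_{(h,j)\in\mathcal K}\widehat\mu_{h,j}-b_h$ are eliminated; (iv) $\mathcal K$ becomes the set of children of the remaining nodes and $h$ becomes $h+1$. The run is stopped after $T$ rounds, possibly within a phase. If $x_{m,t}$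 is the point pulled by client $m$ in round $t$, the regret is $R(T)=\sum_{m=1}^M\sum_{t=1}^T\bigl(f^*-f(x_{m,t})\bigr)$. **Theorem.** $R(T)$ is integrable and $$\mathbb E[R(T)]\le C_1M^{1-\frac1{2\log_k\rho}}+C_2\,M^{\frac{d+1}{d+2}}T^{\frac{d+1}{d+2}}(\log MT)^{\frac1{d+2}},$$ where $$C_1=\frac{48k\nu_1}{\rho^2-\rho^3}\Bigl(\frac{\nu_1^2}{c^2}\Bigr)^{-\frac1{2\log_k\rho}}+1,\qquad C_2=2\left(\frac{24kCc^2\rho^{-(d+3)}(12\nu_1)^{d+1}}{\nu_1(\rho^{-(d+1)}-1)}\right)^{\frac1{d+2}}(1+\log c_1).$$ If $c_1=(2M)^{1/8}$, the factor $1+\log c_1$ in $C_2$ may be replaced by $5/4$, so that $C_1$ and $C_2$ depend on neither $M$ nor $T$. -/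

import Mathlib

open MeasureTheory ProbabilityTheory

noncomputable section

namespace FedPNE

/-- A `k`-ary hierarchical partition of `X`. The nodes of depth `h` are indexed by `i < k ^ h`
(indices start at `0`); the children of `(h, i)` are `(h + 1, k * i + j)`, `j < k`. Every node
`(h, i)` carries a representative point `rep h i`, the arm that is pulled when the node is. -/
structure HierarchicalPartition (X : Type*) (k : ℕ) where
  cell : ℕ → ℕ → Set X
  rep : ℕ → ℕ → X
  cell_zero : cell 0 0 = Set.univ
  cell_children : ∀ h i, i < k ^ h → cell h i = ⋃ j ∈ Finset.range k, cell (h + 1) (k * i + j)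
  cell_disjoint : ∀ h i j, i < k ^ h → j < k ^ h → i ≠ j → Disjoint (cell h i) (cell h j)
  rep_mem : ∀ h i, i < k ^ h → rep h i ∈ cell h i

/-- The global objective: the average of the local objectives. -/
def globalObjective {X : Type*} {M : ℕ} (floc : Fin M → X → ℝ) (x : X) : ℝ :=
  (∑ m, floc m x) / M

/-- The global optimum `f* = sup f`. -/
def optimum {X : Type*} (f : X → ℝ) : ℝ := ⨆ x, f x

/-- Local smoothness: `ℓ` is a dissimilarity function, cells of depth `h` have `ℓ`-diameter at most
`ν₁ ρ ^ h`, and `f` is weakly Lipschitz with respect to `ℓ`. -/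
structure LocalSmoothness {X : Type*} {k : ℕ} (P : HierarchicalPartition X k) (ℓ : X → X → ℝ)
    (f : X → ℝ) (ν₁ ρ : ℝ) : Prop where
  dissim_nonneg : ∀ x y, 0 ≤ ℓ x y
  dissim_self : ∀ x, ℓ x x = 0
  diam_le : ∀ h i, i < k ^ h → ∀ x ∈ P.cell h i, ∀ y ∈ P.cell h i, ℓ x y ≤ ν₁ * ρ ^ h
  weak_lipschitz : ∀ x y,
    optimum f - f y ≤ optimum f - f x + max (optimum f - f x) (ℓ x y)

open Classical in
/-- The nodes of depth `h` whose representative point is `ε`-optimal. -/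
def nearOptimalNodes {X : Type*} {k : ℕ} (P : HierarchicalPartition X k) (f : X → ℝ)
    (h : ℕ) (ε : ℝ) : Finset ℕ :=
  (Finset.range (k ^ h)).filter fun i => optimum f - f (P.rep h i) ≤ ε

/-- `f` has near-optimality dimension `d` with constant `C`: for every depth `h` there are at most
`C (ρ ^ h) ^ (-d)` nodes of depth `h` that are `6 ν₁ ρ ^ h`-optimal. -/
def NearOptimalityDimension {X : Type*} {k : ℕ} (P : HierarchicalPartition X k) (f : X → ℝ)
    (ν₁ ρ C d : ℝ) : Prop :=
  ∀ h : ℕ, ((nearOptimalNodes P f h (6 * ν₁ * ρ ^ h)).card : ℝ) ≤ C * (ρ ^ h) ^ (-d)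

/-- The reward model. `R m t x` is the random reward that client `m` receives if it pulls the arm
`x` in round `t` (rounds start at `0`). Rewards lie in `[0, 1]`, have mean `f_m(x)`, and the rewards
of distinct clients or distinct rounds are independent. -/
structure RewardModel {X Ω : Type*} [MeasurableSpace Ω] (μ : Measure Ω) {M : ℕ}
    (floc : Fin M → X → ℝ) (R : Fin M → ℕ → X → Ω → ℝ) : Prop where
  measurable : ∀ m t x, Measurable (R m t x)
  mem_Icc : ∀ m t x, ∀ᵐ ω ∂μ, R m t x ω ∈ Set.Icc (0 : ℝ) 1
  mean : ∀ m t x, ∫ ω, R m t x ω ∂μ = floc m x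
  indep : iIndepFun (fun (q : Fin M × ℕ) (ω : Ω) (x : X) => R q.1 q.2 x ω) μ

/-- The parameters of the algorithm: arity `k`, number `M` of clients, horizon `T`, smoothness
parameters `ν₁`, `ρ`, confidence parameters `c`, `c₁`, `δ`. -/
structure Params where
  k : ℕ
  M : ℕ
  T : ℕ
  ν₁ : ℝ
  ρ : ℝ
  c : ℝ
  c₁ : ℝ
  δ : ℝ

/-- `log (c₁ T / δ)`. -/
def logTerm (a : Params) : ℝ := Real.log (a.c₁ * a.T / a.δ)

/-- The threshold `τ_h = ⌈c² log (c₁ T / δ) / ν₁² · ρ ^ (-2h)⌉`. -/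
def threshold (a : Params) (h : ℕ) : ℕ :=
  ⌈a.c ^ 2 * logTerm a / a.ν₁ ^ 2 * (a.ρ ^ (2 * h))⁻¹⌉₊

/-- The number `⌈τ_h / M⌉` of pulls of a node of depth `h` by each client. -/
def pulls (a : Params) (h : ℕ) : ℕ := ⌈(threshold a h : ℝ) / a.M⌉₊

/-- The confidence width `c √(log (c₁ T / δ) / (M ⌈τ_h / M⌉))` of a node of depth `h`. -/
def confWidth (a : Params) (h : ℕ) : ℝ :=
  a.c * Real.sqrt (logTerm a / ((a.M * pulls a h : ℕ) : ℝ))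

/-- All the children of the nodes in `K`. -/
def children (k : ℕ) (K : Finset ℕ) : Finset ℕ :=
  K.biUnion fun i => (Finset.range k).image fun j => k * i + j

/-- A phase: its first round, the depth of its nodes, and the indices of its nodes. -/
structure Phase where
  start : ℕ
  depth : ℕ
  nodes : Finset ℕ

/-- The number of rounds of a phase. -/
def Phase.length (a : Params) (p : Phase) : ℕ := p.nodes.card * pulls a p.depth

/-- The guard of the expansion loop. -/
def MustExpand (a : Params) (h : ℕ) (K : Finset ℕ) : Prop :=
  K.card * threshold a h ≤ a.M ∨ threshold a h ≤ 1

/-- The number of passes through the loop that replaces `K` by its children and increases `h`, for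
as long as the guard holds. -/
def expansionSteps (a : Params) (h : ℕ) (K : Finset ℕ) : ℕ :=
  sInf {j : ℕ | ¬ MustExpand a (h + j) ((children a.k)^[j] K)}

/-- The phase that starts in round `s` once the expansion loop has been run from `(h, K)`. -/
def openPhase (a : Params) (s h : ℕ) (K : Finset ℕ) : Phase where
  start := s
  depth := h + expansionSteps a h K
  nodes := (children a.k)^[expansionSteps a h K] K

/-- In a phase every client pulls the nodes one after the other, in increasing order, each of them
`pulls a depth` times in a row. This is the node pulled in round `t` of the phase. -/
def Phase.nodeAt (a : Params) (p : Phase) (t : ℕ) : ℕ :=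
  (p.nodes.sort (· ≤ ·)).getD ((t - p.start) / pulls a p.depth) 0

section Run

variable {X : Type*} (a : Params) (P : HierarchicalPartition X a.k) (r : Fin a.M → ℕ → X → ℝ)

/-- The mean of the rewards that client `m` received from node `i` in phase `p`, when `r` is the
realization of the rewards. -/
def localMean (p : Phase) (m : Fin a.M) (i : ℕ) : ℝ :=
  (∑ t ∈ (Finset.Ico p.start (p.start + p.length a)).filter (fun t => p.nodeAt a t = i),
    r m t (P.rep p.depth i)) / pulls a p.depth

/-- The server's estimate for node `i` in phase `p`. -/
def globalMean (p : Phase) (i : ℕ) : ℝ := (∑ m, localMean a P r p m i) / a.M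

open Classical in
/-- The nodes eliminated at the end of phase `p`; `j` is a maximizer of the server's estimates. -/
def eliminated (p : Phase) : Finset ℕ :=
  p.nodes.filter fun i => ∃ j ∈ p.nodes,
    (∀ j' ∈ p.nodes, globalMean a P r p j' ≤ globalMean a P r p j) ∧
    globalMean a P r p i + confWidth a p.depth + a.ν₁ * a.ρ ^ p.depth
      < globalMean a P r p j - confWidth a p.depth

/-- The successive phases of Fed-PNE. The first one is opened with the children of the root, each
later one with the children of the nodes that were not eliminated in the phase before. -/
def phase : ℕ → Phase
  | 0 => openPhase a 0 1 (children a.k {0})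
  | n + 1 =>
    let p := phase n
    openPhase a (p.start + p.length a) (p.depth + 1)
      (children a.k (p.nodes \ eliminated a P r p))

/-- The phase to which round `t` belongs. -/
def currentPhase (t : ℕ) : Phase :=
  phase a P r (sInf {n : ℕ | t < (phase a P r n).start + (phase a P r n).length a})

/-- The arm pulled by client `m` in round `t`; the server gives the same schedule to all clients. -/
def arm (_m : Fin a.M) (t : ℕ) : X :=
  P.rep (currentPhase a P r t).depth ((currentPhase a P r t).nodeAt a t)

/-- The cumulative regret of the `M` clients over the rounds `0, …, T - 1`. -/
def regret (f : X → ℝ) : ℝ :=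
  ∑ m : Fin a.M, ∑ t ∈ Finset.range a.T, (optimum f - f (arm a P r m t))

end Run

/-- The constant `C₁`. -/
def constC₁ (k : ℕ) (ν₁ ρ c : ℝ) : ℝ :=
  48 * k * ν₁ / (ρ ^ 2 - ρ ^ 3) * (ν₁ ^ 2 / c ^ 2) ^ (-(1 / (2 * Real.logb k ρ))) + 1

/-- The constant `C₂` up to the factor that depends on `c₁`. -/
def constC₂ (k : ℕ) (ν₁ ρ c C d : ℝ) : ℝ :=
  2 * (24 * k * C * c ^ 2 * ρ ^ (-(d + 3)) * (12 * ν₁) ^ (d + 1)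
    / (ν₁ * (ρ ^ (-(d + 1)) - 1))) ^ (1 / (d + 2))

/-- `M ^ ((d+1)/(d+2)) T ^ ((d+1)/(d+2)) (log (M T)) ^ (1/(d+2))`. -/
def regretRate (M T : ℕ) (d : ℝ) : ℝ :=
  (M : ℝ) ^ ((d + 1) / (d + 2)) * (T : ℝ) ^ ((d + 1) / (d + 2))
    * Real.log ((M : ℝ) * T) ^ (1 / (d + 2))

end FedPNE

end

/-! The deterministic part takes place on the event `Accurate`: every estimate of a phase completed
within the horizon is within its confidence width b_h of the true mean. The number of pulls is tuned
so that b_h ≤ ν₁ρ^h (`confWidth_le`). On this event a node whose cell contains points of value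
arbitrarily close to f* is never eliminated, and whatever survives at depth h is 6ν₁ρ^h-optimal
(`baseNodes_invariant`). So there are at most Cρ^(-dh) survivors, and by weak Lipschitz continuity
all their descendants have regret at most 12ν₁ρ^h.

A phase opened from survivors of depth g is of one of two kinds (`mul_length_le`). Either it takes
at most 2kρ^(-2)MQ pulls over all clients, where Q bounds k^h at the depths whose level is at most
M. Since the depths g strictly increase, these phases contribute a geometric series in ρ^g, which is
the C₁ term. Or its pulls are bounded by 2k times the number of survivors times the level of depth g
+ 1, and its regret is of order ρ^(-(d+1)g). In `regret_le_of_accurate` the second bound serves for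
g < J, while for g ≥ J each of the at most MT pulls costs at most 12ν₁ρ^J. Balancing the two in
`exists_depth_tradeoff` gives the C₂ term.

For the probability of the event, Hoeffding's inequality applies to a fixed phase, whereas phases
are random. Causality resolves this: a phase is determined by the rewards before its first round,
its estimates by the rewards during it, so the two are independent (`measure_phase_inter_deviation`)
and one sums over the countably many possible phases. A union bound over T phases and T nodes,
multiplied by the trivial regret MT, costs at most 1 in expectation. The bound on Q uses log(c₁T/δ)
≥ 1, so the cases T = 1 and MT = 2 are treated apart in `integral_regret_le`. -/

namespace FedPNE

/-! ### Thresholds, numbers of pulls and confidence widths -/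

/-- The standing assumptions on the parameters. -/
structure Params.Admissible (a : Params) : Prop where
  two_le_k : 2 ≤ a.k
  one_le_M : 1 ≤ a.M
  ν₁_pos : 0 < a.ν₁
  ρ_pos : 0 < a.ρ
  ρ_lt_one : a.ρ < 1
  two_le_c : 2 ≤ a.c
  logTerm_pos : 0 < logTerm a

/-- The quantity `c² log (c₁ T / δ) / ν₁² · ρ ^ (-2 * h)` whose ceiling is the threshold. -/
noncomputable def level (a : Params) (h : ℕ) : ℝ :=
  a.c ^ 2 * logTerm a / a.ν₁ ^ 2 * (a.ρ ^ (2 * h))⁻¹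

theorem level_le_threshold (a : Params) (h : ℕ) : level a h ≤ threshold a h := Nat.le_ceil _

section

variable {a : Params} (ha : a.Admissible)
include ha

theorem Params.Admissible.c_pos : 0 < a.c := lt_of_lt_of_le two_pos ha.two_le_c

theorem Params.Admissible.M_pos : (0 : ℝ) < a.M := by exact_mod_cast ha.one_le_M

theorem Params.Admissible.k_pos : 0 < a.k := lt_of_lt_of_le two_pos ha.two_le_k

theorem level_pos (h : ℕ) : 0 < level a h := by
  have := ha.c_pos; have := ha.logTerm_pos; have := ha.ν₁_pos; have := ha.ρ_pos
  unfold level; positivity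

theorem level_succ (h : ℕ) : level a (h + 1) = (a.ρ ^ 2)⁻¹ * level a h := by
  have := ha.ρ_pos
  unfold level
  rw [show 2 * (h + 1) = 2 + 2 * h by ring, pow_add, mul_inv]; ring

theorem threshold_pos (h : ℕ) : 0 < threshold a h := Nat.ceil_pos.2 (level_pos ha h)

theorem threshold_le_mul_pulls (h : ℕ) : threshold a h ≤ a.M * pulls a h := by
  have h1 : (threshold a h : ℝ) / a.M ≤ pulls a h := Nat.le_ceil _
  rw [div_le_iff₀ ha.M_pos] at h1
  rw [mul_comm]; exact_mod_cast h1

theorem pulls_pos (h : ℕ) : 0 < pulls a h := by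
  have := threshold_le_mul_pulls ha h
  have := threshold_pos ha h
  exact Nat.pos_of_ne_zero fun h0 => by simp only [h0, mul_zero] at *; omega

theorem mul_pulls_le (h : ℕ) : (a.M : ℝ) * pulls a h ≤ level a h + a.M := by
  have h1 : (pulls a h : ℝ) < (threshold a h : ℝ) / a.M + 1 :=
    Nat.ceil_lt_add_one (by positivity)
  have h2 : (a.M : ℝ) * pulls a h < threshold a h + a.M := by
    calc (a.M : ℝ) * pulls a h < a.M * ((threshold a h : ℝ) / a.M + 1) :=
          mul_lt_mul_of_pos_left h1 ha.M_pos
      _ = threshold a h + a.M := by have := ha.M_pos; field_simp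
  -- Passing to integers turns the strict inequality into a gain of 1, which pays for the ceiling in
  -- `threshold`.
  have h3 : a.M * pulls a h + 1 ≤ threshold a h + a.M := by exact_mod_cast h2
  have h4 : (a.M : ℝ) * pulls a h + 1 ≤ threshold a h + a.M := by exact_mod_cast h3
  have h5 : (threshold a h : ℝ) < level a h + 1 := Nat.ceil_lt_add_one (level_pos ha h).le
  linarith

theorem confWidth_nonneg (h : ℕ) : 0 ≤ confWidth a h :=
  mul_nonneg ha.c_pos.le (Real.sqrt_nonneg _)

theorem confWidth_sq (h : ℕ) :
    ((a.M * pulls a h : ℕ) : ℝ) * confWidth a h ^ 2 = a.c ^ 2 * logTerm a := by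
  have h0 : (0 : ℝ) < ((a.M * pulls a h : ℕ) : ℝ) := by
    exact_mod_cast Nat.mul_pos ha.one_le_M (pulls_pos ha h)
  rw [confWidth, mul_pow, Real.sq_sqrt (div_nonneg ha.logTerm_pos.le h0.le)]
  field_simp

/-- The level is the sample size at which the squared width equals (ν₁ρ^h)²; rounding up only adds
samples. -/
theorem confWidth_le (h : ℕ) : confWidth a h ≤ a.ν₁ * a.ρ ^ h := by
  have hν := ha.ν₁_pos; have hρ := ha.ρ_pos; have hL := ha.logTerm_pos; have hc := ha.c_pos
  have h0 : level a h ≤ ((a.M * pulls a h : ℕ) : ℝ) :=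
    (level_le_threshold a h).trans (by exact_mod_cast threshold_le_mul_pulls ha h)
  have h1 := confWidth_sq ha h
  have h2 : level a h * (a.ν₁ * a.ρ ^ h) ^ 2 = a.c ^ 2 * logTerm a := by
    unfold level; field_simp; ring
  have h3 : confWidth a h ^ 2 ≤ (a.ν₁ * a.ρ ^ h) ^ 2 := by
    have h4 : level a h * confWidth a h ^ 2 ≤ level a h * (a.ν₁ * a.ρ ^ h) ^ 2 := by
      rw [h2, ← h1]; exact mul_le_mul_of_nonneg_right h0 (sq_nonneg _)
    exact le_of_mul_le_mul_left h4 (level_pos ha h)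
  exact le_of_sq_le_sq h3 (by positivity)

end

/-! ### Children and the expansion loop -/

theorem mem_children {k : ℕ} {K : Finset ℕ} {i : ℕ} :
    i ∈ children k K ↔ ∃ i' ∈ K, ∃ j < k, k * i' + j = i := by
  simp [children]

theorem card_children {k : ℕ} (K : Finset ℕ) : (children k K).card = k * K.card := by
  rw [children, Finset.card_biUnion]
  · rw [Finset.sum_congr rfl (g := fun _ => k), Finset.sum_const, smul_eq_mul, mul_comm]
    intro i _
    rw [Finset.card_image_of_injective _ (fun x y h => by simpa using h), Finset.card_range]
  · intro i _ j _ hij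
    rw [Function.onFun, Finset.disjoint_left]
    rintro x hx hx'
    simp only [Finset.mem_image, Finset.mem_range] at hx hx'
    obtain ⟨u, hu, rfl⟩ := hx
    obtain ⟨v, hv, hv'⟩ := hx'
    apply hij
    have h1 := congrArg (· / k) hv'
    have hk : 0 < k := by omega
    simpa [Nat.mul_add_div hk, Nat.div_eq_of_lt hu, Nat.div_eq_of_lt hv] using h1.symm

theorem card_children_iterate {k : ℕ} (K : Finset ℕ) (j : ℕ) :
    ((children k)^[j] K).card = k ^ j * K.card := by
  induction j with
  | zero => simp
  | succ j ih => rw [Function.iterate_succ_apply', card_children, ih]; ring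

theorem children_subset_range {k h : ℕ} {K : Finset ℕ} (hK : K ⊆ Finset.range (k ^ h)) :
    children k K ⊆ Finset.range (k ^ (h + 1)) := by
  intro i hi
  obtain ⟨i', hi', j, hj, rfl⟩ := mem_children.1 hi
  have h1 := Finset.mem_range.1 (hK hi')
  rw [Finset.mem_range, pow_succ']
  calc k * i' + j < k * i' + k := by omega
    _ = k * (i' + 1) := by ring
    _ ≤ k * k ^ h := Nat.mul_le_mul_left _ h1

theorem children_iterate_subset_range {k h : ℕ} {K : Finset ℕ} (hK : K ⊆ Finset.range (k ^ h))
    (j : ℕ) : (children k)^[j] K ⊆ Finset.range (k ^ (h + j)) := by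
  induction j with
  | zero => simpa using hK
  | succ j ih => rw [Function.iterate_succ_apply', ← add_assoc]; exact children_subset_range ih

theorem children_iterate_nonempty {k : ℕ} (hk : 0 < k) {K : Finset ℕ} (hK : K.Nonempty) (j : ℕ) :
    ((children k)^[j] K).Nonempty := by
  rw [← Finset.card_pos, card_children_iterate]
  exact Nat.mul_pos (Nat.pow_pos hk) hK.card_pos

/-- Minimality of the infimum is all that is used about the expansion loop; its termination plays no
role in the bounds. -/
theorem mustExpand_of_lt_expansionSteps {a : Params} {h j : ℕ} {K : Finset ℕ}
    (hj : j < expansionSteps a h K) : MustExpand a (h + j) ((children a.k)^[j] K) := by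
  by_contra hcon
  exact absurd (Nat.sInf_le (s := {j : ℕ | ¬ MustExpand a (h + j) ((children a.k)^[j] K)}) hcon)
    (not_le.2 hj)

/-! ### The rounds of a phase -/

theorem card_filter_nodeAt {a : Params} (ha : a.Admissible) (p : Phase) {i : ℕ}
    (hi : i ∈ p.nodes) :
    ((Finset.Ico p.start (p.start + p.length a)).filter (fun t => p.nodeAt a t = i)).card
      = pulls a p.depth := by
  have hq := pulls_pos ha p.depth
  set q := pulls a p.depth with hqdef
  set l := p.nodes.sort (· ≤ ·) with hl
  have hlen : l.length = p.nodes.card := Finset.length_sort _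
  have hnd : l.Nodup := Finset.sort_nodup _ _
  obtain ⟨n, hn, hni⟩ := List.getElem_of_mem ((Finset.mem_sort (· ≤ ·)).2 hi)
  -- The node in position n of the sorted list occupies the n-th block of q consecutive rounds.
  -- Inside the phase the index stays within the list, so the default value of `getD` is never
  -- taken.
  have hset : (Finset.Ico p.start (p.start + p.length a)).filter (fun t => p.nodeAt a t = i)
      = Finset.Ico (p.start + n * q) (p.start + (n + 1) * q) := by
    ext t
    simp only [Finset.mem_filter, Finset.mem_Ico, Phase.nodeAt, Phase.length, ← hqdef, ← hl]
    constructor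
    · rintro ⟨⟨h1, h2⟩, h3⟩
      have h4 : (t - p.start) / q < l.length := by
        rw [hlen, Nat.div_lt_iff_lt_mul hq]; omega
      rw [List.getD_eq_getElem _ _ h4, ← hni] at h3
      have h5 := (hnd.getElem_inj_iff).1 h3
      rw [Nat.div_eq_iff hq] at h5
      rw [add_mul, one_mul]; omega
    · rintro ⟨h1, h2⟩
      have h5 : (t - p.start) / q = n := by
        rw [Nat.div_eq_iff hq]; rw [add_mul, one_mul] at h2; omega
      have h6 : (n + 1) * q ≤ p.nodes.card * q := Nat.mul_le_mul_right _ (hlen ▸ hn)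
      refine ⟨⟨by omega, by omega⟩, ?_⟩
      rw [h5, List.getD_eq_getElem _ _ hn, hni]
  rw [hset, Nat.card_Ico]
  have : p.start + (n + 1) * q = p.start + n * q + q := by ring
  omega

theorem nodeAt_mem {a : Params} (ha : a.Admissible) (p : Phase) {t : ℕ} (h1 : p.start ≤ t)
    (h2 : t < p.start + p.length a) : p.nodeAt a t ∈ p.nodes := by
  have hq := pulls_pos ha p.depth
  have h4 : (t - p.start) / pulls a p.depth < (p.nodes.sort (· ≤ ·)).length := by
    rw [Finset.length_sort, Nat.div_lt_iff_lt_mul hq]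
    unfold Phase.length at h2; omega
  rw [Phase.nodeAt, List.getD_eq_getElem _ _ h4]
  exact (Finset.mem_sort (· ≤ ·)).1 (List.getElem_mem h4)

/-! ### The sequence of phases -/

section Run

variable {X : Type*} {a : Params} (P : HierarchicalPartition X a.k) (r : Fin a.M → ℕ → X → ℝ)

/-- The depth of the nodes from whose children phase `n` is opened. -/
noncomputable def baseDepth (a : Params) (P : HierarchicalPartition X a.k)
    (r : Fin a.M → ℕ → X → ℝ) : ℕ → ℕ
  | 0 => 0
  | n + 1 => (phase a P r n).depth

/-- The nodes from whose children phase `n` is opened: the root, or the nodes that survive the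
preceding phase. -/
noncomputable def baseNodes (a : Params) (P : HierarchicalPartition X a.k)
    (r : Fin a.M → ℕ → X → ℝ) : ℕ → Finset ℕ
  | 0 => {0}
  | n + 1 => (phase a P r n).nodes \ eliminated a P r (phase a P r n)

theorem phase_depth (n : ℕ) : (phase a P r n).depth = baseDepth a P r n + 1 +
    expansionSteps a (baseDepth a P r n + 1) (children a.k (baseNodes a P r n)) := by
  cases n <;> rfl

theorem phase_nodes (n : ℕ) : (phase a P r n).nodes = (children a.k)^[1 +
    expansionSteps a (baseDepth a P r n + 1) (children a.k (baseNodes a P r n))]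
      (baseNodes a P r n) := by
  rw [add_comm, Function.iterate_succ_apply]
  cases n <;> rfl

theorem phase_start_succ (n : ℕ) :
    (phase a P r (n + 1)).start = (phase a P r n).start + (phase a P r n).length a := rfl

theorem baseDepth_lt_succ (n : ℕ) : baseDepth a P r n < baseDepth a P r (n + 1) := by
  have h := phase_depth P r n
  change _ < (phase a P r n).depth
  omega

theorem baseDepth_strictMono : StrictMono (baseDepth a P r) :=
  strictMono_nat_of_lt_succ (baseDepth_lt_succ P r)

theorem exists_maximizer {p : Phase} (hp : p.nodes.Nonempty) :
    ∃ j ∈ p.nodes, ∀ j' ∈ p.nodes, globalMean a P r p j' ≤ globalMean a P r p j :=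
  Finset.exists_max_image _ _ hp

variable (ha : a.Admissible)
include ha

theorem sdiff_eliminated_nonempty {p : Phase} (hp : p.nodes.Nonempty) :
    (p.nodes \ eliminated a P r p).Nonempty := by
  obtain ⟨j, hj, hmax⟩ := exists_maximizer P r hp
  refine ⟨j, ?_⟩
  simp only [eliminated, Finset.mem_sdiff, Finset.mem_filter, not_and, not_exists]
  refine ⟨hj, fun _ j' hj' _ => ?_⟩
  have h1 := hmax j' hj'
  have h2 := confWidth_nonneg ha p.depth
  have h3 : 0 ≤ a.ν₁ * a.ρ ^ p.depth := mul_nonneg ha.ν₁_pos.le (pow_nonneg ha.ρ_pos.le _)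
  linarith

theorem baseNodes_nonempty (n : ℕ) : (baseNodes a P r n).Nonempty := by
  induction n with
  | zero => exact ⟨0, by simp [baseNodes]⟩
  | succ n ih =>
    refine sdiff_eliminated_nonempty P r ha ?_
    rw [phase_nodes]
    exact children_iterate_nonempty ha.k_pos ih _

theorem phase_nodes_nonempty (n : ℕ) : (phase a P r n).nodes.Nonempty := by
  rw [phase_nodes]
  exact children_iterate_nonempty ha.k_pos (baseNodes_nonempty P r ha n) _

theorem phase_length_pos (n : ℕ) : 0 < (phase a P r n).length a :=
  Nat.mul_pos (phase_nodes_nonempty P r ha n).card_pos (pulls_pos ha _)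

theorem phase_start_strictMono : StrictMono fun n => (phase a P r n).start :=
  strictMono_nat_of_lt_succ fun n => by
    have := phase_length_pos P r ha n
    have := phase_start_succ P r n
    omega

theorem le_phase_start (n : ℕ) : n ≤ (phase a P r n).start :=
  (phase_start_strictMono P r ha).le_apply

omit ha in
theorem baseNodes_subset_range (n : ℕ) :
    baseNodes a P r n ⊆ Finset.range (a.k ^ baseDepth a P r n) := by
  induction n with
  | zero => simp [baseNodes, baseDepth]
  | succ n ih =>
    refine Finset.sdiff_subset.trans ?_
    have h := children_iterate_subset_range ih (1 +
      expansionSteps a (baseDepth a P r n + 1) (children a.k (baseNodes a P r n)))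
    rw [← phase_nodes, ← add_assoc, ← phase_depth] at h
    exact h

/-- The index of the phase to which round `t` belongs. -/
noncomputable def phaseIndex (a : Params) (P : HierarchicalPartition X a.k)
    (r : Fin a.M → ℕ → X → ℝ) (t : ℕ) : ℕ :=
  sInf {n : ℕ | t < (phase a P r n).start + (phase a P r n).length a}

theorem lt_phaseIndex_end (t : ℕ) : t < (phase a P r (phaseIndex a P r t)).start +
    (phase a P r (phaseIndex a P r t)).length a := by
  -- Every phase has at least one round, so phase t ends after round t.
  have hne : {n : ℕ | t < (phase a P r n).start + (phase a P r n).length a}.Nonempty := by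
    refine ⟨t, ?_⟩
    have := le_phase_start P r ha t
    have := phase_length_pos P r ha t
    simp only [Set.mem_ofPred_eq]
    omega
  exact Nat.sInf_mem hne

omit ha in
theorem end_le_of_lt_phaseIndex {t n : ℕ} (hn : n < phaseIndex a P r t) :
    (phase a P r n).start + (phase a P r n).length a ≤ t := by
  by_contra hcon
  exact absurd (Nat.sInf_le
    (s := {n : ℕ | t < (phase a P r n).start + (phase a P r n).length a}) (not_le.1 hcon))
    (not_le.2 hn)

omit ha in
theorem phaseIndex_start_le (t : ℕ) : (phase a P r (phaseIndex a P r t)).start ≤ t := by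
  rcases h : phaseIndex a P r t with _ | n
  · exact Nat.zero_le _
  · rw [phase_start_succ]
    exact end_le_of_lt_phaseIndex P r (by omega)

theorem phaseIndex_nodeAt_mem (t : ℕ) :
    (phase a P r (phaseIndex a P r t)).nodeAt a t ∈ (phase a P r (phaseIndex a P r t)).nodes :=
  nodeAt_mem ha _ (phaseIndex_start_le P r t) (lt_phaseIndex_end P r ha t)

theorem card_filter_phaseIndex_le (T n : ℕ) :
    ((Finset.range T).filter fun t => phaseIndex a P r t = n).card ≤ (phase a P r n).length a := by
  have hsub : (Finset.range T).filter (fun t => phaseIndex a P r t = n) ⊆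
      Finset.Ico (phase a P r n).start ((phase a P r n).start + (phase a P r n).length a) := by
    intro t ht
    obtain ⟨-, rfl⟩ := Finset.mem_filter.1 ht
    exact Finset.mem_Ico.2 ⟨phaseIndex_start_le P r t, lt_phaseIndex_end P r ha t⟩
  simpa using Finset.card_le_card hsub

/-! ### Causality -/

omit ha in
theorem globalMean_congr {r r' : Fin a.M → ℕ → X → ℝ} {p : Phase}
    (h : ∀ m t x, p.start ≤ t → t < p.start + p.length a → r m t x = r' m t x) :
    globalMean a P r p = globalMean a P r' p := by
  funext i
  unfold globalMean localMean
  congr 1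
  refine Finset.sum_congr rfl fun m _ => ?_
  congr 1
  refine Finset.sum_congr rfl fun t ht => ?_
  have ht' := Finset.mem_Ico.1 (Finset.mem_filter.1 ht).1
  exact h m t _ ht'.1 ht'.2

omit ha in
theorem eliminated_congr {r r' : Fin a.M → ℕ → X → ℝ} {p : Phase}
    (h : ∀ m t x, t < p.start + p.length a → r m t x = r' m t x) :
    eliminated a P r p = eliminated a P r' p := by
  unfold eliminated
  rw [globalMean_congr P fun m t x _ ht => h m t x ht]

omit ha in
-- Causality: eliminations use only rewards of phases already completed. By induction, agreement of
-- the rewards before the first round of phase n forces agreement of all the decisions that lead to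
-- it.
theorem phase_congr {r r' : Fin a.M → ℕ → X → ℝ} (n : ℕ)
    (h : ∀ m t x, t < (phase a P r n).start → r m t x = r' m t x) :
    phase a P r n = phase a P r' n := by
  induction n with
  | zero => rfl
  | succ n ih =>
    rw [phase_start_succ] at h
    have h1 := ih fun m t x ht => h m t x (by omega)
    simp only [phase]
    rw [← h1, eliminated_congr P h]

/-! ### Measurability -/

omit ha in
theorem measurable_globalMean (p : Phase) (i : ℕ) :
    Measurable fun r : Fin a.M → ℕ → X → ℝ => globalMean a P r p i := by
  unfold globalMean localMean
  fun_prop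

omit ha in
theorem measurableSet_eliminated_eq (p : Phase) (E : Finset ℕ) :
    MeasurableSet {r : Fin a.M → ℕ → X → ℝ | eliminated a P r p = E} := by
  have hmem : ∀ i, MeasurableSet {r : Fin a.M → ℕ → X → ℝ | i ∈ eliminated a P r p} := by
    intro i
    have h1 : {r : Fin a.M → ℕ → X → ℝ | i ∈ eliminated a P r p} =
        ⋃ j ∈ p.nodes, {_r | i ∈ p.nodes} ∩
          ((⋂ j' ∈ p.nodes, {r | globalMean a P r p j' ≤ globalMean a P r p j}) ∩
          {r | globalMean a P r p i + confWidth a p.depth + a.ν₁ * a.ρ ^ p.depth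
            < globalMean a P r p j - confWidth a p.depth}) := by
      ext r
      simp only [eliminated, Finset.mem_filter, Set.mem_ofPred_eq, Set.mem_iUnion,
        Set.mem_inter_iff, Set.mem_iInter, exists_prop]
      exact ⟨fun ⟨hi, j, hj, h⟩ => ⟨j, hj, hi, h⟩, fun ⟨j, hj, hi, h⟩ => ⟨hi, j, hj, h⟩⟩
    rw [h1]
    refine Finset.measurableSet_biUnion _ fun j _ => (MeasurableSet.const _).inter
      ((Finset.measurableSet_biInter _ fun j' _ => ?_).inter ?_)
    · exact measurableSet_le (measurable_globalMean P p j') (measurable_globalMean P p j)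
    · exact measurableSet_lt (((measurable_globalMean P p i).add_const _).add_const _)
        ((measurable_globalMean P p j).sub_const _)
  have h2 : {r : Fin a.M → ℕ → X → ℝ | eliminated a P r p = E} =
      ⋂ i, {r : Fin a.M → ℕ → X → ℝ | i ∈ eliminated a P r p ↔ i ∈ E} := by
    ext r; simp [Finset.ext_iff]
  rw [h2]
  refine MeasurableSet.iInter fun i => ?_
  by_cases hi : i ∈ E
  · simp only [hi, iff_true]
    exact hmem i
  · simp only [hi, iff_false]
    exact (hmem i).compl

instance : Countable Phase := by
  have : Function.Injective fun p : Phase => (p.start, p.depth, p.nodes) := by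
    rintro ⟨⟩ ⟨⟩ h
    simp_all
  exact this.countable

omit ha in
-- There are countably many phases and finite node sets, so the event splits into a countable union
-- over the preceding phase and the set it eliminates.
theorem measurableSet_phase_eq (n : ℕ) (p : Phase) :
    MeasurableSet {r : Fin a.M → ℕ → X → ℝ | phase a P r n = p} := by
  induction n generalizing p with
  | zero => exact MeasurableSet.const (openPhase a 0 1 (children a.k {0}) = p)
  | succ n ih =>
    have h1 : {r : Fin a.M → ℕ → X → ℝ | phase a P r (n + 1) = p} =
        ⋃ q : Phase, ⋃ E : Finset ℕ, {r : Fin a.M → ℕ → X → ℝ | phase a P r n = q} ∩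
          ({r : Fin a.M → ℕ → X → ℝ | eliminated a P r q = E} ∩ {_r |
            openPhase a (q.start + q.length a) (q.depth + 1) (children a.k (q.nodes \ E))
              = p}) := by
      ext r
      simp [phase]
    rw [h1]
    exact MeasurableSet.iUnion fun q => MeasurableSet.iUnion fun E =>
      (ih q).inter ((measurableSet_eliminated_eq P q E).inter (MeasurableSet.const _))

theorem measurableSet_currentPhase_eq (t : ℕ) (p : Phase) :
    MeasurableSet {r : Fin a.M → ℕ → X → ℝ | currentPhase a P r t = p} := by
  have hend : ∀ n, MeasurableSet {r : Fin a.M → ℕ → X → ℝ |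
      t < (phase a P r n).start + (phase a P r n).length a} := by
    intro n
    have h1 : {r : Fin a.M → ℕ → X → ℝ | t < (phase a P r n).start + (phase a P r n).length a} =
        ⋃ q : Phase, {r | phase a P r n = q} ∩ {_r | t < q.start + q.length a} := by
      ext r; simp
    rw [h1]
    exact MeasurableSet.iUnion fun q => (measurableSet_phase_eq P n q).inter (MeasurableSet.const _)
  have h2 : {r : Fin a.M → ℕ → X → ℝ | currentPhase a P r t = p} =
      ⋃ n : ℕ, {r | phase a P r n = p} ∩
        ({r | t < (phase a P r n).start + (phase a P r n).length a} ∩ ⋂ n' : ℕ, ⋂ _ : n' < n,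
          {r | t < (phase a P r n').start + (phase a P r n').length a}ᶜ) := by
    ext r
    simp only [Set.mem_ofPred_eq, Set.mem_iUnion, Set.mem_inter_iff, Set.mem_iInter,
      Set.mem_compl_iff]
    constructor
    · rintro h
      refine ⟨phaseIndex a P r t, h, lt_phaseIndex_end P r ha t, fun n' hn' => ?_⟩
      exact not_lt.2 (end_le_of_lt_phaseIndex P r hn')
    · rintro ⟨n, hn, h1, h3⟩
      have h4 : phaseIndex a P r t = n := by
        refine le_antisymm (Nat.sInf_le h1) (not_lt.1 fun hlt => ?_)
        exact h3 _ hlt (lt_phaseIndex_end P r ha t)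
      rw [← hn, ← h4]
      rfl
  rw [h2]
  exact MeasurableSet.iUnion fun n => (measurableSet_phase_eq P n p).inter ((hend n).inter
    (MeasurableSet.iInter fun n' => MeasurableSet.iInter fun _ => (hend n').compl))

theorem measurable_regret (f : X → ℝ) :
    Measurable fun r : Fin a.M → ℕ → X → ℝ => regret a P r f := by
  let _ : MeasurableSpace Phase := ⊤
  have h1 : ∀ t, Measurable fun r : Fin a.M → ℕ → X → ℝ => currentPhase a P r t := fun t =>
    measurable_to_countable' fun p => measurableSet_currentPhase_eq P ha t p
  unfold regret
  refine Finset.measurable_sum _ fun m _ => Finset.measurable_sum _ fun t _ => ?_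
  exact (measurable_from_top (f := fun p : Phase =>
    optimum f - f (P.rep p.depth (p.nodeAt a t)))).comp (h1 t)

end Run

/-! ### Concentration of the server's estimates -/

section Concentration

variable {X Ω : Type*} [MeasurableSpace Ω] {μ : Measure Ω} [IsProbabilityMeasure μ]

/-- Hoeffding's inequality with variance proxy 1/4; the sign σ provides both tails at once. -/
theorem RewardModel.measure_sum_ge_le {M : ℕ} {floc : Fin M → X → ℝ}
    {R : Fin M → ℕ → X → Ω → ℝ} (hR : RewardModel μ floc R) (x : X)
    (s : Finset (Fin M × ℕ)) {σ : ℝ} (hσ : |σ| = 1) {ε : ℝ} (hε : 0 ≤ ε) :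
    μ.real {ω | ε ≤ ∑ q ∈ s, σ * (R q.1 q.2 x ω - floc q.1 x)}
      ≤ Real.exp (-2 * ε ^ 2 / s.card) := by
  have hind : iIndepFun (fun (q : Fin M × ℕ) ω => σ * (R q.1 q.2 x ω - floc q.1 x)) μ :=
    hR.indep.comp (fun q (y : X → ℝ) => σ * (y x - floc q.1 x)) fun q => by fun_prop
  have hsub : ∀ q ∈ s, HasSubgaussianMGF
      (fun ω => σ * (R q.1 q.2 x ω - floc q.1 x)) (1 / 4) μ := by
    intro q _
    have h1 := hasSubgaussianMGF_of_mem_Icc (hR.measurable q.1 q.2 x).aemeasurable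
      (hR.mem_Icc q.1 q.2 x)
    rw [hR.mean] at h1
    have h2 : (‖(1 : ℝ) - 0‖₊ / 2) ^ 2 = 1 / 4 := by
      rw [sub_zero, nnnorm_one, div_pow]
      norm_num
    rw [h2] at h1
    rcases (abs_eq zero_le_one).1 hσ with rfl | rfl
    · simpa only [one_mul] using h1
    · simp only [neg_one_mul]
      exact h1.neg
  have h3 := HasSubgaussianMGF.measure_sum_ge_le_of_iIndepFun hind hsub hε
  refine h3.trans_eq ?_
  congr 1
  rw [Finset.sum_const]
  simp only [nsmul_eq_mul, NNReal.coe_mul, NNReal.coe_natCast, NNReal.coe_div, NNReal.coe_one,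
    NNReal.coe_ofNat]
  rcases Nat.eq_zero_or_pos s.card with h0 | h0
  · simp [h0]
  · have : (0 : ℝ) < s.card := by exact_mod_cast h0
    field_simp
    norm_num

variable {a : Params} (ha : a.Admissible) (P : HierarchicalPartition X a.k)
  {floc : Fin a.M → X → ℝ} {R : Fin a.M → ℕ → X → Ω → ℝ} (hR : RewardModel μ floc R)

include ha in
theorem globalMean_sub (r : Fin a.M → ℕ → X → ℝ) (p : Phase) {i : ℕ} (hi : i ∈ p.nodes) :
    ((a.M * pulls a p.depth : ℕ) : ℝ) *
        (globalMean a P r p i - globalObjective floc (P.rep p.depth i)) =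
      ∑ q ∈ Finset.univ ×ˢ (Finset.Ico p.start (p.start + p.length a)).filter
          (fun t => p.nodeAt a t = i),
        (r q.1 q.2 (P.rep p.depth i) - floc q.1 (P.rep p.depth i)) := by
  have hM := ha.M_pos
  have hq : (0 : ℝ) < pulls a p.depth := by exact_mod_cast pulls_pos ha p.depth
  rw [Finset.sum_product]
  simp only [Finset.sum_sub_distrib, Finset.sum_const, card_filter_nodeAt ha p hi, nsmul_eq_mul]
  rw [← Finset.mul_sum]
  unfold globalMean localMean globalObjective
  rw [← Finset.sum_div]
  push_cast
  field_simp

include ha hR in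
theorem measure_deviation_le (p : Phase) {i : ℕ} (hi : i ∈ p.nodes) :
    μ {ω | confWidth a p.depth < |globalMean a P (fun m t x => R m t x ω) p i -
        globalObjective floc (P.rep p.depth i)|}
      ≤ ENNReal.ofReal (2 * Real.exp (-2 * (a.c ^ 2 * logTerm a))) := by
  set B := (Finset.Ico p.start (p.start + p.length a)).filter (fun t => p.nodeAt a t = i) with hB
  set s : Finset (Fin a.M × ℕ) := Finset.univ ×ˢ B with hs
  set N : ℝ := ((a.M * pulls a p.depth : ℕ) : ℝ) with hN
  have hcard : (s.card : ℝ) = N := by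
    rw [hs, Finset.card_product, hB, card_filter_nodeAt ha p hi]
    simp [hN]
  have hNpos : 0 < N := by
    rw [hN]; exact_mod_cast Nat.mul_pos ha.one_le_M (pulls_pos ha p.depth)
  have hb := confWidth_nonneg ha p.depth
  -- Here N is the number of samples of the node, so the exponent is -2Nb², and Nb² = c² log(c₁T/δ)
  -- at every depth.
  have hexp : -2 * (N * confWidth a p.depth) ^ 2 / s.card = -2 * (a.c ^ 2 * logTerm a) := by
    rw [← confWidth_sq ha p.depth, hcard, ← hN]
    field_simp
  have key : ∀ σ : ℝ, |σ| = 1 → μ {ω | N * confWidth a p.depth ≤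
      ∑ q ∈ s, σ * (R q.1 q.2 (P.rep p.depth i) ω - floc q.1 (P.rep p.depth i))} ≤
      ENNReal.ofReal (Real.exp (-2 * (a.c ^ 2 * logTerm a))) := by
    intro σ hσ
    rw [← ofReal_measureReal (measure_ne_top _ _)]
    refine ENNReal.ofReal_le_ofReal ?_
    rw [← hexp]
    exact hR.measure_sum_ge_le _ s hσ (by positivity)
  calc _ ≤ μ ({ω | N * confWidth a p.depth ≤
          ∑ q ∈ s, 1 * (R q.1 q.2 (P.rep p.depth i) ω - floc q.1 (P.rep p.depth i))} ∪
        {ω | N * confWidth a p.depth ≤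
          ∑ q ∈ s, (-1) * (R q.1 q.2 (P.rep p.depth i) ω - floc q.1 (P.rep p.depth i))}) := by
        refine measure_mono fun ω hω => ?_
        have h1 := globalMean_sub (floc := floc) ha P (fun m t x => R m t x ω) p hi
        simp only [Set.mem_union, Set.mem_ofPred_eq, ← Finset.mul_sum] at hω ⊢
        rw [← h1, ← hN]
        rcases lt_abs.1 hω with h | h
        · left; rw [one_mul]; exact (mul_lt_mul_of_pos_left h hNpos).le
        · right; have := (mul_lt_mul_of_pos_left h hNpos).le; linarith
    _ ≤ _ := (measure_union_le _ _).trans (add_le_add (key 1 (by simp)) (key (-1) (by simp)))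
    _ = _ := by rw [← ENNReal.ofReal_add (by positivity) (by positivity)]; ring_nf

/-- The rewards on a finite set of pairs (client, round), continued by zero. -/
noncomputable def extendByZero {M : ℕ} (S : Finset (Fin M × ℕ)) (u : S → X → ℝ) :
    Fin M → ℕ → X → ℝ := by
  classical exact fun m t x => if h : (m, t) ∈ S then u ⟨(m, t), h⟩ x else 0

theorem measurable_extendByZero {M : ℕ} (S : Finset (Fin M × ℕ)) :
    Measurable (extendByZero (X := X) S) := by
  refine measurable_pi_iff.2 fun m => measurable_pi_iff.2 fun t => measurable_pi_iff.2 fun x => ?_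
  unfold extendByZero
  by_cases h : (m, t) ∈ S
  · simp only [h, dite_true]; fun_prop
  · simp only [h, dite_false]; fun_prop

theorem extendByZero_apply {M : ℕ} {S : Finset (Fin M × ℕ)} (r : Fin M → ℕ → X → ℝ) {m : Fin M}
    {t : ℕ} (h : (m, t) ∈ S) (x : X) :
    extendByZero S (fun q : S => r q.1.1 q.1.2) m t x = r m t x := by
  simp [extendByZero, h]

omit [IsProbabilityMeasure μ] in
include hR in
-- Both events are rewritten as events on finite blocks of rewards, before and during p. The
-- remaining rewards may be set to zero without changing either event, and the blocks are disjoint,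
-- hence independent.
theorem measure_phase_inter_deviation (n : ℕ) (p : Phase) (i : ℕ) (y b : ℝ) :
    μ ({ω | phase a P (fun m t x => R m t x ω) n = p} ∩
        {ω | b < |globalMean a P (fun m t x => R m t x ω) p i - y|}) =
      μ {ω | phase a P (fun m t x => R m t x ω) n = p} *
        μ {ω | b < |globalMean a P (fun m t x => R m t x ω) p i - y|} := by
  let S : Finset (Fin a.M × ℕ) := Finset.univ ×ˢ Finset.range p.start
  let S' : Finset (Fin a.M × ℕ) := Finset.univ ×ˢ Finset.Ico p.start (p.start + p.length a)
  have hdisj : Disjoint S S' := by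
    rw [Finset.disjoint_left]
    intro q hq hq'
    simp only [S, S', Finset.mem_product, Finset.mem_range, Finset.mem_Ico] at hq hq'
    omega
  have hind := hR.indep.indepFun_finset S S' hdisj
    fun q => measurable_pi_iff.2 fun x => hR.measurable q.1 q.2 x
  have hA : MeasurableSet {u : S → X → ℝ | phase a P (extendByZero S u) n = p} :=
    measurable_extendByZero S (measurableSet_phase_eq P n p)
  have hB : MeasurableSet {u : S' → X → ℝ |
      b < |globalMean a P (extendByZero S' u) p i - y|} := by
    refine measurableSet_lt measurable_const ?_
    exact (((measurable_globalMean P p i).comp (measurable_extendByZero S')).sub_const y).abs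
  have h1 : {ω | phase a P (fun m t x => R m t x ω) n = p} =
      (fun ω (q : S) (x : X) => R q.1.1 q.1.2 x ω) ⁻¹'
        {u : S → X → ℝ | phase a P (extendByZero S u) n = p} := by
    ext ω
    have hag : ∀ m t x, t < p.start → R m t x ω =
        extendByZero S (fun q : S => fun x => R q.1.1 q.1.2 x ω) m t x := fun m t x ht =>
      (extendByZero_apply (fun m t x => R m t x ω) (by simp [S, ht]) x).symm
    simp only [Set.mem_ofPred_eq, Set.mem_preimage]
    constructor
    · intro h
      rw [← h]
      exact (phase_congr P n fun m t x ht => hag m t x (by rwa [h] at ht)).symm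
    · intro h
      rw [← h]
      exact (phase_congr P n fun m t x ht => (hag m t x (by rwa [h] at ht)).symm).symm
  have h2 : {ω | b < |globalMean a P (fun m t x => R m t x ω) p i - y|} =
      (fun ω (q : S') (x : X) => R q.1.1 q.1.2 x ω) ⁻¹'
        {u : S' → X → ℝ | b < |globalMean a P (extendByZero S' u) p i - y|} := by
    ext ω
    have hg : globalMean a P (fun m t x => R m t x ω) p =
        globalMean a P (extendByZero S' (fun q : S' => fun x => R q.1.1 q.1.2 x ω)) p :=
      globalMean_congr P fun m t x ht ht' =>
        (extendByZero_apply (fun m t x => R m t x ω) (by simp [S', ht, ht']) x).symm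
    simp only [Set.mem_ofPred_eq, Set.mem_preimage, hg]
  rw [h1, h2]
  exact hind.measure_inter_preimage_eq_mul _ _ hA hB

/-- For the rewards `r`, all the estimates computed within the horizon are accurate. -/
def Accurate (a : Params) (P : HierarchicalPartition X a.k) (f : X → ℝ)
    (r : Fin a.M → ℕ → X → ℝ) : Prop :=
  ∀ n, (phase a P r n).start + (phase a P r n).length a ≤ a.T → ∀ i ∈ (phase a P r n).nodes,
    |globalMean a P r (phase a P r n) i - f (P.rep (phase a P r n).depth i)| ≤
      confWidth a (phase a P r n).depth

include ha hR in
theorem measure_not_accurate_le :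
    μ {ω | ¬ Accurate a P (globalObjective floc) (fun m t x => R m t x ω)} ≤
      a.T * (a.T * ENNReal.ofReal (2 * Real.exp (-2 * (a.c ^ 2 * logTerm a)))) := by
  set ε := ENNReal.ofReal (2 * Real.exp (-2 * (a.c ^ 2 * logTerm a))) with hε
  let r : Ω → Fin a.M → ℕ → X → ℝ := fun ω m t x => R m t x ω
  have hr : Measurable r := measurable_pi_iff.2 fun m => measurable_pi_iff.2 fun t =>
    measurable_pi_iff.2 fun x => hR.measurable m t x
  let dev : Phase → ℕ → Set Ω := fun p i => {ω | confWidth a p.depth <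
    |globalMean a P (r ω) p i - globalObjective floc (P.rep p.depth i)|}
  let V : ℕ → Phase → Set Ω := fun n p => {ω | phase a P (r ω) n = p}
  -- Phases that overrun the horizon are discarded. In the others every node takes at least one
  -- round, which leaves at most T nodes for the union bound.
  let I : Phase → Finset ℕ := fun p => if p.start + p.length a ≤ a.T then p.nodes else ∅
  have hI : ∀ p, (I p).card ≤ a.T := by
    intro p
    by_cases h : p.start + p.length a ≤ a.T
    · have h1 : p.nodes.card ≤ p.length a := Nat.le_mul_of_pos_right _ (pulls_pos ha _)
      simp only [I, h, if_true]
      omega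
    · simp [I, h]
  have hV : ∀ n, ∑' p, μ (V n p) ≤ 1 := fun n => by
    refine (tsum_meas_le_meas_iUnion_of_disjoint μ
      (fun p => hr (measurableSet_phase_eq P n p)) ?_).trans prob_le_one
    intro p q hpq
    refine Set.disjoint_left.2 fun ω h1 h2 => hpq ?_
    exact (show phase a P (r ω) n = p from h1).symm.trans h2
  have hsub : {ω | ¬ Accurate a P (globalObjective floc) (r ω)} ⊆
      ⋃ n ∈ Finset.range a.T, ⋃ p : Phase, ⋃ i ∈ I p, V n p ∩ dev p i := by
    intro ω hω
    simp only [Accurate, Set.mem_ofPred_eq, not_forall, not_le] at hω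
    obtain ⟨n, hn, i, hi, hdev⟩ := hω
    have h1 := le_phase_start P (r ω) ha n
    have h2 := phase_length_pos P (r ω) ha n
    simp only [Set.mem_iUnion, Finset.mem_range, exists_prop]
    refine ⟨n, by omega, phase a P (r ω) n, i, ?_, rfl, hdev⟩
    simp only [I, hn, if_true]
    exact hi
  have hphase : ∀ n p, μ (⋃ i ∈ I p, V n p ∩ dev p i) ≤ μ (V n p) * (a.T * ε) := by
    intro n p
    calc μ (⋃ i ∈ I p, V n p ∩ dev p i) ≤ ∑ i ∈ I p, μ (V n p ∩ dev p i) :=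
          measure_biUnion_finset_le _ _
      _ ≤ ∑ i ∈ I p, μ (V n p) * ε := by
          refine Finset.sum_le_sum fun i hi => ?_
          have hi' : i ∈ p.nodes := by
            by_cases h : p.start + p.length a ≤ a.T
            · simpa [I, h] using hi
            · simp [I, h] at hi
          exact (measure_phase_inter_deviation P hR n p i _ _).trans_le
            (mul_le_mul_right (measure_deviation_le ha P hR p hi') _)
      _ = (I p).card * (μ (V n p) * ε) := by simp
      _ ≤ a.T * (μ (V n p) * ε) := mul_le_mul_left (by exact_mod_cast hI p) _
      _ = μ (V n p) * (a.T * ε) := by ring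
  calc μ {ω | ¬ Accurate a P (globalObjective floc) (r ω)}
      ≤ μ (⋃ n ∈ Finset.range a.T, ⋃ p : Phase, ⋃ i ∈ I p, V n p ∩ dev p i) := measure_mono hsub
    _ ≤ ∑ n ∈ Finset.range a.T, μ (⋃ p : Phase, ⋃ i ∈ I p, V n p ∩ dev p i) :=
        measure_biUnion_finset_le _ _
    _ ≤ ∑ n ∈ Finset.range a.T, a.T * ε := by
        refine Finset.sum_le_sum fun n _ => ?_
        calc μ (⋃ p : Phase, ⋃ i ∈ I p, V n p ∩ dev p i)
            ≤ ∑' p, μ (⋃ i ∈ I p, V n p ∩ dev p i) := measure_iUnion_le _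
          _ ≤ ∑' p, μ (V n p) * (a.T * ε) := ENNReal.tsum_le_tsum fun p => hphase n p
          _ = (∑' p, μ (V n p)) * (a.T * ε) := ENNReal.tsum_mul_right
          _ ≤ 1 * (a.T * ε) := mul_le_mul_left (hV n) _
          _ = a.T * ε := one_mul _
    _ = a.T * (a.T * ε) := by simp

end Concentration

/-! ### Optimal cells and the regret of the nodes of a phase -/

section Optimal

variable {X : Type*} {k : ℕ} {P : HierarchicalPartition X k} {f : X → ℝ} {ℓ : X → X → ℝ} {ν₁ ρ : ℝ}

/-- The node `(h, i)` is optimal: its cell contains points of value arbitrarily close to `f*`. -/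
def IsOptimalNode (P : HierarchicalPartition X k) (f : X → ℝ) (h i : ℕ) : Prop :=
  ∀ ε > 0, ∃ x ∈ P.cell h i, optimum f - f x < ε

theorem isOptimalNode_root (P : HierarchicalPartition X k) : IsOptimalNode P f 0 0 := by
  intro ε hε
  have : Nonempty X := ⟨P.rep 0 0⟩
  obtain ⟨x, hx⟩ := exists_lt_of_lt_ciSup (show optimum f - ε < ⨆ x, f x by
    change optimum f - ε < optimum f; linarith)
  exact ⟨x, by simp [P.cell_zero], by linarith⟩

/-- A node has finitely many children: if each stayed a positive distance below f*, the smallest of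
these distances would separate the parent from f* as well. -/
theorem IsOptimalNode.exists_child {h i : ℕ} (hi : i < k ^ h) (hopt : IsOptimalNode P f h i) :
    ∃ j < k, IsOptimalNode P f (h + 1) (k * i + j) := by
  by_contra! hcon
  simp only [IsOptimalNode, not_forall] at hcon
  push Not at hcon
  choose! ε hε hε' using hcon
  have hk : (Finset.range k).Nonempty := by
    obtain ⟨x, hx, -⟩ := hopt 1 one_pos
    rw [P.cell_children h i hi] at hx
    simp only [Set.mem_iUnion] at hx
    obtain ⟨j, hj, -⟩ := hx
    exact ⟨j, hj⟩
  obtain ⟨j₀, hj₀, hmin⟩ := Finset.exists_min_image _ ε hk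
  obtain ⟨x, hx, hxε⟩ := hopt (ε j₀) (hε j₀ (Finset.mem_range.1 hj₀))
  rw [P.cell_children h i hi] at hx
  simp only [Set.mem_iUnion] at hx
  obtain ⟨j, hj, hxj⟩ := hx
  have h1 := hε' j (Finset.mem_range.1 hj) x hxj
  have h2 := hmin j hj
  linarith

theorem exists_isOptimalNode_children_iterate {h : ℕ} {K : Finset ℕ}
    (hK : K ⊆ Finset.range (k ^ h)) (hopt : ∃ i ∈ K, IsOptimalNode P f h i) (j : ℕ) :
    ∃ i ∈ (children k)^[j] K, IsOptimalNode P f (h + j) i := by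
  induction j with
  | zero => simpa using hopt
  | succ j ih =>
    obtain ⟨i, hi, hio⟩ := ih
    obtain ⟨u, hu, huo⟩ :=
      hio.exists_child (Finset.mem_range.1 (children_iterate_subset_range hK j hi))
    refine ⟨k * i + u, ?_, huo⟩
    rw [Function.iterate_succ_apply']
    exact mem_children.2 ⟨i, hi, u, hu, rfl⟩

theorem exists_cell_subset_of_mem_children_iterate (P : HierarchicalPartition X k) {h : ℕ}
    {K : Finset ℕ} (hK : K ⊆ Finset.range (k ^ h)) (j : ℕ) :
    ∀ i ∈ (children k)^[j] K, ∃ i' ∈ K, P.cell (h + j) i ⊆ P.cell h i' := by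
  induction j with
  | zero => intro i hi; exact ⟨i, hi, subset_rfl⟩
  | succ j ih =>
    intro i hi
    rw [Function.iterate_succ_apply'] at hi
    obtain ⟨i₁, hi₁, u, hu, rfl⟩ := mem_children.1 hi
    obtain ⟨i', hi', hsub⟩ := ih i₁ hi₁
    refine ⟨i', hi', Set.Subset.trans ?_ hsub⟩
    rw [P.cell_children _ _ (Finset.mem_range.1 (children_iterate_subset_range hK j hi₁))]
    exact Set.subset_biUnion_of_mem (u := fun j' => P.cell (h + j + 1) (k * i₁ + j'))
      (Finset.mem_coe.2 (Finset.mem_range.2 hu))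

theorem IsOptimalNode.regret_le (hs : LocalSmoothness P ℓ f ν₁ ρ) {h i : ℕ} (hi : i < k ^ h)
    (hopt : IsOptimalNode P f h i) {y : X} (hy : y ∈ P.cell h i) :
    optimum f - f y ≤ ν₁ * ρ ^ h := by
  refine le_of_forall_pos_le_add fun ε hε => ?_
  obtain ⟨x, hx, hxε⟩ := hopt (ε / 2) (by positivity)
  have h1 := hs.weak_lipschitz x y
  have h2 := hs.diam_le h i hi x hx y hy
  have h3 : 0 ≤ ν₁ * ρ ^ h := (hs.dissim_nonneg x y).trans h2
  have h4 : max (optimum f - f x) (ℓ x y) ≤ ε / 2 + ν₁ * ρ ^ h :=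
    max_le (by linarith) (by linarith)
  linarith

theorem LocalSmoothness.regret_le_two_mul (hs : LocalSmoothness P ℓ f ν₁ ρ) {h i : ℕ}
    (hi : i < k ^ h) {B : ℝ} (hB : ν₁ * ρ ^ h ≤ B) (hrep : optimum f - f (P.rep h i) ≤ B)
    {y : X} (hy : y ∈ P.cell h i) : optimum f - f y ≤ 2 * B := by
  have h1 := hs.weak_lipschitz (P.rep h i) y
  have h2 := hs.diam_le h i hi _ (P.rep_mem h i hi) y hy
  have h4 : max (optimum f - f (P.rep h i)) (ℓ (P.rep h i) y) ≤ B :=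
    max_le hrep (h2.trans hB)
  linarith

end Optimal

/-! ### Near-optimality of the surviving nodes -/

section Run

variable {X : Type*} {a : Params} (ha : a.Admissible) {P : HierarchicalPartition X a.k}
  {f : X → ℝ} {ℓ : X → X → ℝ} (hs : LocalSmoothness P ℓ f a.ν₁ a.ρ)
  (hf : ∀ x, f x ≤ optimum f) {r : Fin a.M → ℕ → X → ℝ} (hr : Accurate a P f r)
include ha hs hf hr

/-- As long as the estimates are accurate, an optimal node survives, and all the surviving nodes
are near-optimal. -/
theorem baseNodes_invariant (n : ℕ) (hn : ∀ n' < n,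
      (phase a P r n').start + (phase a P r n').length a ≤ a.T) :
    (∃ i ∈ baseNodes a P r n, IsOptimalNode P f (baseDepth a P r n) i) ∧
    ∀ i ∈ baseNodes a P r n, optimum f - f (P.rep (baseDepth a P r n) i) ≤
      6 * (a.ν₁ * a.ρ ^ baseDepth a P r n) := by
  induction n with
  | zero =>
    refine ⟨⟨0, by simp [baseNodes], isOptimalNode_root P⟩, fun i hi => ?_⟩
    obtain rfl : i = 0 := by simpa [baseNodes] using hi
    have h1 := (isOptimalNode_root (f := f) P).regret_le hs (by simp) (P.rep_mem 0 0 (by simp))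
    have := ha.ν₁_pos
    simp only [baseDepth, pow_zero, mul_one] at h1 ⊢
    linarith
  | succ n ih =>
    obtain ⟨hopt, -⟩ := ih fun n' hn' => hn n' (by omega)
    have hsub := baseNodes_subset_range P r n
    set p := phase a P r n with hp
    obtain ⟨i₀, hi₀, hi₀opt⟩ := exists_isOptimalNode_children_iterate hsub hopt (1 +
      expansionSteps a (baseDepth a P r n + 1) (children a.k (baseNodes a P r n)))
    have hrange := children_iterate_subset_range hsub (1 +
      expansionSteps a (baseDepth a P r n + 1) (children a.k (baseNodes a P r n)))
    rw [← phase_nodes, ← add_assoc, ← phase_depth, ← hp] at hrange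
    rw [← phase_nodes, ← hp] at hi₀
    rw [← add_assoc, ← phase_depth, ← hp] at hi₀opt
    have hacc := hr n (hn n (by omega))
    rw [← hp] at hacc
    have hi₀lt := Finset.mem_range.1 (hrange hi₀)
    have hreg := hi₀opt.regret_le hs hi₀lt (P.rep_mem _ _ hi₀lt)
    have hb := confWidth_le ha p.depth
    have hacc₀ := abs_le.1 (hacc i₀ hi₀)
    change (∃ i ∈ p.nodes \ eliminated a P r p, IsOptimalNode P f p.depth i) ∧
      ∀ i ∈ p.nodes \ eliminated a P r p, optimum f - f (P.rep p.depth i) ≤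
        6 * (a.ν₁ * a.ρ ^ p.depth)
    refine ⟨⟨i₀, ?_, hi₀opt⟩, fun i hi => ?_⟩
    -- The optimal node i₀ has regret at most ν₁ρ^h, so its upper bound enlarged by ν₁ρ^h is at
    -- least f*, and no lower bound exceeds f*.
    · simp only [eliminated, Finset.mem_sdiff, Finset.mem_filter, not_and, not_exists]
      refine ⟨hi₀, fun _ j hj _ => ?_⟩
      have h1 := abs_le.1 (hacc j hj)
      have h2 := hf (P.rep p.depth j)
      linarith
    -- Comparing a survivor with i₀ through the maximizer j loses four widths and 2ν₁ρ^h; each width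
    -- is at most ν₁ρ^h, hence the 6.
    · simp only [eliminated, Finset.mem_sdiff, Finset.mem_filter, not_and, not_exists] at hi
      obtain ⟨hi, hi'⟩ := hi
      obtain ⟨j, hj, hjmax⟩ := exists_maximizer P r (p := p) ⟨i, hi⟩
      have h1 := hi' hi j hj hjmax
      have h2 := hjmax i₀ hi₀
      have h3 := abs_le.1 (hacc i hi)
      linarith

theorem regret_phase_le (n : ℕ) (hn : ∀ n' < n,
      (phase a P r n').start + (phase a P r n').length a ≤ a.T)
    {i : ℕ} (hi : i ∈ (phase a P r n).nodes) :
    optimum f - f (P.rep (phase a P r n).depth i) ≤ 12 * a.ν₁ * a.ρ ^ baseDepth a P r n := by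
  obtain ⟨-, hall⟩ := baseNodes_invariant ha hs hf hr n hn
  have hsub := baseNodes_subset_range P r n
  have hrange := children_iterate_subset_range hsub (1 +
    expansionSteps a (baseDepth a P r n + 1) (children a.k (baseNodes a P r n)))
  have hcell := exists_cell_subset_of_mem_children_iterate P hsub (1 +
    expansionSteps a (baseDepth a P r n + 1) (children a.k (baseNodes a P r n)))
  rw [← phase_nodes, ← add_assoc, ← phase_depth] at hrange hcell
  obtain ⟨i', hi', hsub'⟩ := hcell i hi
  have h0 : 0 ≤ a.ν₁ * a.ρ ^ baseDepth a P r n :=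
    mul_nonneg ha.ν₁_pos.le (pow_nonneg ha.ρ_pos.le _)
  have h1 := hs.regret_le_two_mul (Finset.mem_range.1 (hsub hi')) (by linarith) (hall i' hi')
    (hsub' (P.rep_mem _ _ (Finset.mem_range.1 (hrange hi))))
  linarith

theorem card_baseNodes_le {C d : ℝ} (hdim : NearOptimalityDimension P f a.ν₁ a.ρ C d) (n : ℕ)
    (hn : ∀ n' < n, (phase a P r n').start + (phase a P r n').length a ≤ a.T) :
    ((baseNodes a P r n).card : ℝ) ≤ C * (a.ρ ^ baseDepth a P r n) ^ (-d) := by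
  obtain ⟨-, hall⟩ := baseNodes_invariant ha hs hf hr n hn
  refine le_trans ?_ (hdim (baseDepth a P r n))
  refine Nat.cast_le.2 (Finset.card_le_card fun i hi => ?_)
  refine Finset.mem_filter.2 ⟨baseNodes_subset_range P r n hi, ?_⟩
  rw [mul_assoc]
  exact hall i hi

end Run

/-! ### The length of a phase and the regret when the estimates are accurate -/

section Run

variable {X : Type*} {a : Params} (ha : a.Admissible) {P : HierarchicalPartition X a.k}

include ha in
/-- A phase is short, with a bound that does not depend on its depth, if the expansion loop was
entered or if its level is at most the number of clients; otherwise its length is governed by the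
number of nodes from which it was opened. -/
theorem mul_length_le (r : Fin a.M → ℕ → X → ℝ) {Q : ℝ}
    (hQ : ∀ h, level a h ≤ a.M → (a.k : ℝ) ^ h ≤ Q) (n : ℕ) :
    (a.M : ℝ) * (phase a P r n).length a ≤ 2 * a.k * (a.ρ ^ 2)⁻¹ * (a.M * Q) ∨
    (a.M : ℝ) * (phase a P r n).length a ≤
      2 * a.k * (baseNodes a P r n).card * level a (baseDepth a P r n + 1) := by
  have hM := ha.M_pos
  have hM1 : (1 : ℝ) ≤ a.M := by exact_mod_cast ha.one_le_M
  have hk : (0 : ℝ) < a.k := by exact_mod_cast ha.k_pos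
  have hk1 : (1 : ℝ) ≤ a.k := by exact_mod_cast ha.k_pos
  have hρi : 1 ≤ (a.ρ ^ 2)⁻¹ :=
    (one_le_inv₀ (pow_pos ha.ρ_pos 2)).2 (pow_le_one₀ ha.ρ_pos.le ha.ρ_lt_one.le)
  have hsub := baseNodes_subset_range P r n
  have hne := baseNodes_nonempty P r ha n
  have hlen : (phase a P r n).length a =
      (phase a P r n).nodes.card * pulls a (phase a P r n).depth := rfl
  rw [hlen, phase_nodes, phase_depth]
  have hexp : ∀ j, j < expansionSteps a (baseDepth a P r n + 1)
      (children a.k (baseNodes a P r n)) → _ := fun j => mustExpand_of_lt_expansionSteps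
  generalize expansionSteps a (baseDepth a P r n + 1) (children a.k (baseNodes a P r n)) = e at *
  generalize baseDepth a P r n = g at *
  generalize baseNodes a P r n = S at *
  rcases e with _ | e
  -- No expansion. The dichotomy is on the level: if it is at most M, rounding up to a multiple of M
  -- dominates and Q bounds the nodes; otherwise rounding at most doubles the level.
  · have hp := mul_pulls_le ha (g + 1)
    have hS : (S.card : ℝ) ≤ (a.k : ℝ) ^ g := by
      exact_mod_cast (Finset.card_le_card hsub).trans (by simp)
    have hcard : ((children a.k)^[1 + 0] S).card = a.k * S.card := by
      simp [card_children]
    rw [hcard, add_zero]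
    push_cast
    by_cases hl : level a (g + 1) ≤ a.M
    · left
      have h1 := hQ _ hl
      have hSQ : (S.card : ℝ) ≤ Q := hS.trans ((pow_le_pow_right₀ hk1 (Nat.le_succ g)).trans h1)
      have hQ0 : 0 ≤ Q := (Nat.cast_nonneg _).trans hSQ
      calc (a.M : ℝ) * (a.k * S.card * pulls a (g + 1))
          = a.k * S.card * (a.M * pulls a (g + 1)) := by ring
        _ ≤ a.k * Q * (2 * a.M) :=
            mul_le_mul (by gcongr) (by linarith) (by positivity) (by positivity)
        _ = 2 * a.k * 1 * (a.M * Q) := by ring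
        _ ≤ 2 * a.k * (a.ρ ^ 2)⁻¹ * (a.M * Q) := by gcongr
    · right
      calc (a.M : ℝ) * (a.k * S.card * pulls a (g + 1))
          = a.k * S.card * (a.M * pulls a (g + 1)) := by ring
        _ ≤ a.k * S.card * (2 * level a (g + 1)) :=
            mul_le_mul_of_nonneg_left (by linarith) (by positivity)
        _ = 2 * a.k * S.card * level a (g + 1) := by ring
  · left
    -- The guard held just before the last pass. Either alternative bounds the level there by M, so
    -- Q bounds the nodes there; the last pass costs only a factor k in nodes and ρ^(-2) in level.
    have hme := hexp e (Nat.lt_succ_self e)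
    rw [← Function.iterate_succ_apply] at hme
    have hrange := children_iterate_subset_range hsub (e + 1)
    have hne' := (children_iterate_nonempty ha.k_pos hne (e + 1)).card_pos
    rw [show 1 + (e + 1) = (e + 1) + 1 by ring, Function.iterate_succ_apply', card_children]
    rw [show g + 1 + e = g + (e + 1) by ring] at hme
    rw [show g + 1 + (e + 1) = g + (e + 1) + 1 by ring]
    generalize (children a.k)^[e + 1] S = K at *
    generalize g + (e + 1) = h at *
    have hK1 : (1 : ℝ) ≤ K.card := by exact_mod_cast hne'
    have hlp := level_pos ha h
    have hlt := level_le_threshold a h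
    have hlM : level a h ≤ a.M := by
      rcases hme with h1 | h1
      · have h2 : threshold a h ≤ a.M := (Nat.le_mul_of_pos_left _ hne').trans h1
        exact hlt.trans (by exact_mod_cast h2)
      · exact hlt.trans ((by exact_mod_cast h1 : (threshold a h : ℝ) ≤ 1).trans hM1)
    have hKQ : (K.card : ℝ) ≤ Q := by
      refine le_trans ?_ (hQ h hlM)
      exact_mod_cast (Finset.card_le_card hrange).trans (by simp)
    have hprod : (K.card : ℝ) * level a h ≤ a.M * Q := by
      rcases hme with h1 | h1
      · have h2 : (K.card : ℝ) * threshold a h ≤ a.M := by exact_mod_cast h1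
        calc (K.card : ℝ) * level a h ≤ K.card * threshold a h := by gcongr
          _ ≤ a.M * 1 := by linarith
          _ ≤ a.M * Q := by gcongr; linarith
      · have h2 : (threshold a h : ℝ) ≤ 1 := by exact_mod_cast h1
        calc (K.card : ℝ) * level a h ≤ Q * 1 := by gcongr; linarith; linarith
          _ ≤ a.M * Q := by nlinarith
    have hp := mul_pulls_le ha (h + 1)
    rw [level_succ ha] at hp
    push_cast
    calc (a.M : ℝ) * (a.k * K.card * pulls a (h + 1))
        = a.k * K.card * (a.M * pulls a (h + 1)) := by ring
      _ ≤ a.k * K.card * ((a.ρ ^ 2)⁻¹ * level a h + a.M) := by gcongr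
      _ = a.k * ((a.ρ ^ 2)⁻¹ * (K.card * level a h) + 1 * (a.M * K.card)) := by ring
      _ ≤ a.k * ((a.ρ ^ 2)⁻¹ * (a.M * Q) + (a.ρ ^ 2)⁻¹ * (a.M * Q)) := by gcongr
      _ = 2 * a.k * (a.ρ ^ 2)⁻¹ * (a.M * Q) := by ring

/-- The exponent d + 1 collects ρ^(-dg) nodes, ρ^(-2g) pulls of each and regret ρ^g per pull. -/
theorem weighted_level_eq (ha : a.Admissible) (C d : ℝ) (g : ℕ) :
    2 * a.k * (C * (a.ρ ^ g) ^ (-d)) * level a (g + 1) * (12 * a.ν₁ * a.ρ ^ g) =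
      24 * a.k * C * a.c ^ 2 * logTerm a / a.ν₁ * (a.ρ ^ 2)⁻¹ * (a.ρ ^ (-(d + 1))) ^ g := by
  have hρ := ha.ρ_pos; have hν := ha.ν₁_pos
  have h1 : (a.ρ ^ (-(d + 1))) ^ g = (a.ρ ^ g) ^ (-d) * (a.ρ ^ g)⁻¹ := by
    rw [← Real.rpow_natCast, ← Real.rpow_mul hρ.le, mul_comm, Real.rpow_natCast_mul hρ.le,
      neg_add, Real.rpow_add (by positivity), Real.rpow_neg_one]
  rw [h1]
  unfold level
  rw [show 2 * (g + 1) = 2 + (g + g) by ring, pow_add, pow_add]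
  field_simp
  ring

variable {f : X → ℝ} {ℓ : X → X → ℝ} (hs : LocalSmoothness P ℓ f a.ν₁ a.ρ)
  (hf : ∀ x, f x ≤ optimum f) {r : Fin a.M → ℕ → X → ℝ} (hr : Accurate a P f r)
include ha hs hf hr

theorem regret_le_of_accurate {C d : ℝ} (hC : 0 < C)
    (hdim : NearOptimalityDimension P f a.ν₁ a.ρ C d) {Q : ℝ} (hQ0 : 0 ≤ Q)
    (hQ : ∀ h, level a h ≤ a.M → (a.k : ℝ) ^ h ≤ Q) (J : ℕ) :
    regret a P r f ≤ 24 * a.k * a.ν₁ / (a.ρ ^ 2 * (1 - a.ρ)) * (a.M * Q) +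
      24 * a.k * C * a.c ^ 2 * logTerm a / a.ν₁ * (a.ρ ^ 2)⁻¹ *
        ∑ j ∈ Finset.range J, (a.ρ ^ (-(d + 1))) ^ j +
      12 * a.ν₁ * a.ρ ^ J * (a.M * a.T) := by
  have hρ := ha.ρ_pos; have hν := ha.ν₁_pos; have hρ1 := ha.ρ_lt_one; have hM := ha.M_pos
  have hL := ha.logTerm_pos; have hc := ha.c_pos
  set D := 24 * a.k * C * a.c ^ 2 * logTerm a / a.ν₁ * (a.ρ ^ 2)⁻¹ with hD
  have hD0 : 0 ≤ D := by positivity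
  set q := a.ρ ^ (-(d + 1)) with hq
  have hq0 : 0 < q := Real.rpow_pos_of_pos hρ _
  let g := baseDepth a P r
  let w : ℕ → ℝ := fun n => 12 * a.ν₁ * a.ρ ^ g n
  let A := (Finset.range a.T).image (phaseIndex a P r)
  let cnt : ℕ → ℕ := fun n => ((Finset.range a.T).filter fun t => phaseIndex a P r t = n).card
  have hmono : StrictMono g := baseDepth_strictMono P r
  -- The phase cut off by the horizon needs no accuracy: the regret of its nodes is controlled by
  -- the earlier phases, all of which are complete.
  have hpast : ∀ n ∈ A, ∀ n' < n,
      (phase a P r n').start + (phase a P r n').length a ≤ a.T := by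
    intro n hn n' hn'
    obtain ⟨t, ht, rfl⟩ := Finset.mem_image.1 hn
    exact (end_le_of_lt_phaseIndex P r hn').trans (Finset.mem_range.1 ht).le
  have hreg : regret a P r f ≤ ∑ n ∈ A, a.M * cnt n * w n := by
    have h1 : ∀ t ∈ Finset.range a.T, ∀ m, optimum f - f (arm a P r m t) ≤
        w (phaseIndex a P r t) := fun t ht m =>
      regret_phase_le ha hs hf hr _ (hpast _ (Finset.mem_image_of_mem _ ht))
        (phaseIndex_nodeAt_mem P r ha t)
    calc regret a P r f ≤ ∑ _m : Fin a.M, ∑ t ∈ Finset.range a.T, w (phaseIndex a P r t) :=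
          Finset.sum_le_sum fun m _ => Finset.sum_le_sum fun t ht => h1 t ht m
      _ = a.M * ∑ n ∈ A, cnt n • w n := by
          rw [Finset.sum_const, Finset.card_univ, Fintype.card_fin, nsmul_eq_mul,
            Finset.sum_comp w]
      _ = ∑ n ∈ A, a.M * cnt n * w n := by
          rw [Finset.mul_sum]
          exact Finset.sum_congr rfl fun n _ => by rw [nsmul_eq_mul]; ring
  have hphase : ∀ n ∈ A, a.M * cnt n * w n ≤
      24 * a.k * a.ν₁ * (a.ρ ^ 2)⁻¹ * (a.M * Q) * a.ρ ^ g n +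
        D * (if g n < J then q ^ g n else 0) + 12 * a.ν₁ * a.ρ ^ J * (a.M * cnt n) := by
    intro n hn
    have hw : 0 ≤ w n := by positivity
    have hcnt : (cnt n : ℝ) ≤ (phase a P r n).length a := by
      exact_mod_cast card_filter_phaseIndex_le P r ha a.T n
    have hle : a.M * cnt n * w n ≤ a.M * (phase a P r n).length a * w n := by gcongr
    have t1 : 0 ≤ 24 * a.k * a.ν₁ * (a.ρ ^ 2)⁻¹ * (a.M * Q) * a.ρ ^ g n := by positivity
    have t2 : 0 ≤ D * (if g n < J then q ^ g n else 0) := by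
      refine mul_nonneg hD0 ?_
      split_ifs <;> positivity
    have t3 : 0 ≤ 12 * a.ν₁ * a.ρ ^ J * (a.M * cnt n) := by positivity
    rcases mul_length_le ha (P := P) r hQ n with h | h
    · have h1 : a.M * (phase a P r n).length a * w n ≤
          2 * a.k * (a.ρ ^ 2)⁻¹ * (a.M * Q) * w n := by gcongr
      have h2 : 2 * a.k * (a.ρ ^ 2)⁻¹ * (a.M * Q) * w n =
          24 * a.k * a.ν₁ * (a.ρ ^ 2)⁻¹ * (a.M * Q) * a.ρ ^ g n := by ring
      linarith
    · by_cases hJ : g n < J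
      · have hl := level_pos ha (g n + 1)
        have hcard := card_baseNodes_le ha hs hf hr hdim n (hpast n hn)
        have h1 : a.M * (phase a P r n).length a * w n ≤
            2 * a.k * (C * (a.ρ ^ g n) ^ (-d)) * level a (g n + 1) * w n := by
          refine mul_le_mul_of_nonneg_right (h.trans ?_) hw
          change 2 * a.k * ((baseNodes a P r n).card : ℝ) * level a (g n + 1) ≤ _
          gcongr
        rw [weighted_level_eq ha] at h1
        rw [if_pos hJ] at t2 ⊢
        linarith
      · have h1 : a.ρ ^ g n ≤ a.ρ ^ J := pow_le_pow_of_le_one hρ.le hρ1.le (not_lt.1 hJ)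
        have h2 : a.M * cnt n * w n ≤ 12 * a.ν₁ * a.ρ ^ J * (a.M * cnt n) := by
          calc a.M * cnt n * w n = 12 * a.ν₁ * a.ρ ^ g n * (a.M * cnt n) := by ring
            _ ≤ _ := by gcongr
        linarith
  have hgeom : ∑ n ∈ A, a.ρ ^ g n ≤ (1 - a.ρ)⁻¹ := by
    rw [← Finset.sum_image (f := fun j => a.ρ ^ j) (hmono.injective.injOn)]
    rw [← tsum_geometric_of_lt_one hρ.le hρ1]
    exact (summable_geometric_of_lt_one hρ.le hρ1).sum_le_tsum _ fun _ _ => by positivity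
  -- Distinct phases have distinct base depths, so a sum over phases is dominated by a sum over
  -- depths.
  have hgeomJ : ∑ n ∈ A, (if g n < J then q ^ g n else 0) ≤ ∑ j ∈ Finset.range J, q ^ j := by
    rw [← Finset.sum_filter,
      ← Finset.sum_image (f := fun j => q ^ j) (hmono.injective.injOn)]
    refine Finset.sum_le_sum_of_subset_of_nonneg ?_ fun _ _ _ => by positivity
    intro j hj
    obtain ⟨n, hn, rfl⟩ := Finset.mem_image.1 hj
    exact Finset.mem_range.2 (Finset.mem_filter.1 hn).2
  have hcnt : ∑ n ∈ A, (a.M * cnt n : ℝ) = a.M * a.T := by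
    rw [← Finset.mul_sum]
    congr 1
    have h1 := Finset.card_eq_sum_card_image (phaseIndex a P r) (Finset.range a.T)
    rw [Finset.card_range] at h1
    exact_mod_cast h1.symm
  calc regret a P r f ≤ _ := hreg.trans (Finset.sum_le_sum hphase)
    _ = 24 * a.k * a.ν₁ * (a.ρ ^ 2)⁻¹ * (a.M * Q) * ∑ n ∈ A, a.ρ ^ g n +
        D * ∑ n ∈ A, (if g n < J then q ^ g n else 0) +
        12 * a.ν₁ * a.ρ ^ J * (a.M * a.T) := by
        rw [Finset.sum_add_distrib, Finset.sum_add_distrib, ← Finset.mul_sum, ← Finset.mul_sum,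
          ← Finset.mul_sum, hcnt]
    _ ≤ 24 * a.k * a.ν₁ * (a.ρ ^ 2)⁻¹ * (a.M * Q) * (1 - a.ρ)⁻¹ +
        D * ∑ j ∈ Finset.range J, q ^ j + 12 * a.ν₁ * a.ρ ^ J * (a.M * a.T) := by gcongr
    _ = _ := by rw [div_eq_mul_inv, mul_inv]; ring

end Run

/-! ### Analytic estimates -/

theorem exists_depth_tradeoff {ρ d D W N : ℝ} (hρ₀ : 0 < ρ) (hρ₁ : ρ < 1) (hd : 0 ≤ d)
    (hD : 0 < D) (hW : 0 < W) (hN : 0 < N) :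
    ∃ J : ℕ, D * ∑ j ∈ Finset.range J, (ρ ^ (-(d + 1))) ^ j + W * ρ ^ J * N ≤
      2 * ((D * ρ ^ (-(d + 1)) * W ^ (d + 1) / (ρ ^ (-(d + 1)) - 1)) ^ (1 / (d + 2)) *
        N ^ ((d + 1) / (d + 2))) := by
  set q := ρ ^ (-(d + 1)) with hq
  have hd2 : 0 < d + 2 := by linarith
  have hq1 : 1 < q := Real.one_lt_rpow_of_pos_of_lt_one_of_neg hρ₀ hρ₁ (by linarith)
  have hq1' : 0 < q - 1 := by linarith
  have hq0 : 0 < q := by linarith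
  set E := D * q / (q - 1) with hE
  have hE0 : 0 < E := by positivity
  -- The real value of ρ^J that solves E y^(-(d+1)) = W N y; both terms of the trade-off are
  -- compared with WNy.
  set y := (E / (W * N)) ^ (1 / (d + 2)) with hy
  have hy0 : 0 < y := by positivity
  have hypow : E = W * N * y ^ (d + 2) := by
    rw [hy, ← Real.rpow_mul (by positivity), one_div_mul_cancel hd2.ne', Real.rpow_one]
    field_simp
  have hval : (D * q * W ^ (d + 1) / (q - 1)) ^ (1 / (d + 2)) * N ^ ((d + 1) / (d + 2)) =
      W * N * y := by
    have h1 : D * q * W ^ (d + 1) / (q - 1) = E * W ^ (d + 1) := by rw [hE]; ring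
    have h2 : N ^ ((d + 1) / (d + 2)) = (N ^ (d + 1)) ^ (1 / (d + 2)) := by
      rw [← Real.rpow_mul hN.le]; ring_nf
    have h3 : E * W ^ (d + 1) * N ^ (d + 1) = (W * N * y) ^ (d + 2) := by
      have h4 : (W * N) ^ (d + 2) = W ^ (d + 1) * N ^ (d + 1) * (W * N) := by
        rw [show d + 2 = (d + 1) + 1 by ring, Real.rpow_add_one (by positivity),
          Real.mul_rpow hW.le hN.le]
      rw [hypow, Real.mul_rpow (by positivity) hy0.le, h4]
      ring
    rw [h1, h2, ← Real.mul_rpow (by positivity) (by positivity), h3,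
      ← Real.rpow_mul (by positivity), mul_one_div_cancel hd2.ne', Real.rpow_one]
  rw [hval]
  have hWNy : 0 < W * N * y := by positivity
  rcases le_total 1 y with h1 | h1
  · refine ⟨0, ?_⟩
    simp only [Finset.range_zero, Finset.sum_empty, mul_zero, pow_zero, mul_one, zero_add]
    nlinarith [mul_pos hW hN]
  -- Rounding: ρ^(n+1) < y ≤ ρ^n. With J = n + 1 the sum is overestimated by a factor q, already
  -- included in E.
  · obtain ⟨n, hn1, hn2⟩ := exists_nat_pow_near_of_lt_one hy0 h1 hρ₀ hρ₁
    refine ⟨n + 1, ?_⟩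
    have hsum : ∑ j ∈ Finset.range (n + 1), q ^ j ≤ q ^ (n + 1) / (q - 1) := by
      rw [geom_sum_eq hq1.ne']
      gcongr
      linarith
    have hqn : q ^ n ≤ y ^ (-(d + 1)) := by
      have : q ^ n = (ρ ^ n) ^ (-(d + 1)) := by
        rw [hq, ← Real.rpow_natCast, ← Real.rpow_mul hρ₀.le, mul_comm,
          Real.rpow_natCast_mul hρ₀.le]
      rw [this]
      exact Real.rpow_le_rpow_of_nonpos hy0 hn2 (by linarith)
    have hfirst : D * ∑ j ∈ Finset.range (n + 1), q ^ j ≤ W * N * y := by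
      calc D * ∑ j ∈ Finset.range (n + 1), q ^ j ≤ D * (q ^ (n + 1) / (q - 1)) := by gcongr
        _ = E * q ^ n := by rw [hE]; ring
        _ ≤ E * y ^ (-(d + 1)) := by gcongr
        _ = W * N * y := by
          rw [hypow, mul_assoc, ← Real.rpow_add hy0]
          ring_nf
          rw [Real.rpow_one]
    have hsecond : W * ρ ^ (n + 1) * N ≤ W * N * y := by
      calc W * ρ ^ (n + 1) * N = W * N * ρ ^ (n + 1) := by ring
        _ ≤ W * N * y := by gcongr
    linarith

theorem pow_le_rpow_of_inv_pow_le {k : ℕ} {ρ y : ℝ} (hk : 2 ≤ k) (hρ₀ : 0 < ρ) (hρ₁ : ρ < 1)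
    (h : ℕ) (hy : (ρ ^ (2 * h))⁻¹ ≤ y) :
    (k : ℝ) ^ h ≤ y ^ (-(1 / (2 * Real.logb k ρ))) := by
  have hk1 : (1 : ℝ) < k := by exact_mod_cast hk
  have hlog : Real.logb k ρ < 0 := Real.logb_neg hk1 hρ₀ hρ₁
  have hp : 0 ≤ -(1 / (2 * Real.logb k ρ)) := by
    rw [neg_nonneg]; exact div_nonpos_of_nonneg_of_nonpos zero_le_one (by linarith)
  refine le_trans (le_of_eq ?_) (Real.rpow_le_rpow (by positivity) hy hp)
  have h1 : ρ = (k : ℝ) ^ Real.logb k ρ := (Real.rpow_logb (by linarith) hk1.ne' hρ₀).symm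
  have h2 : (ρ ^ (2 * h))⁻¹ = (k : ℝ) ^ (-(2 * h * Real.logb k ρ)) := by
    conv_lhs => rw [h1]
    rw [← Real.rpow_natCast, ← Real.rpow_mul (by positivity), ← Real.rpow_neg (by positivity)]
    push_cast
    ring_nf
  rw [h2, ← Real.rpow_mul (by positivity), ← Real.rpow_natCast]
  congr 1
  field_simp [hlog.ne]

theorem constC₂_eq {k : ℕ} {ν₁ ρ c C d L N : ℝ} (hν₁ : 0 < ν₁) (hρ₀ : 0 < ρ) (hρ₁ : ρ < 1)
    (hC : 0 < C) (hd : 0 ≤ d) (hL : 0 ≤ L) :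
    2 * ((24 * k * C * c ^ 2 * L / ν₁ * (ρ ^ 2)⁻¹ * ρ ^ (-(d + 1)) * (12 * ν₁) ^ (d + 1) /
        (ρ ^ (-(d + 1)) - 1)) ^ (1 / (d + 2)) * N) =
      constC₂ k ν₁ ρ c C d * L ^ (1 / (d + 2)) * N := by
  have hq1 : 1 < ρ ^ (-(d + 1)) :=
    Real.one_lt_rpow_of_pos_of_lt_one_of_neg hρ₀ hρ₁ (by linarith)
  have hq1' : 0 < ρ ^ (-(d + 1)) - 1 := by linarith
  have h1 : ρ ^ (-(d + 3)) = (ρ ^ 2)⁻¹ * ρ ^ (-(d + 1)) := by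
    rw [show -(d + 3) = -2 + -(d + 1) by ring, Real.rpow_add hρ₀, Real.rpow_neg hρ₀.le]
    norm_num
  have h2 : 24 * k * C * c ^ 2 * L / ν₁ * (ρ ^ 2)⁻¹ * ρ ^ (-(d + 1)) * (12 * ν₁) ^ (d + 1) /
        (ρ ^ (-(d + 1)) - 1) =
      24 * k * C * c ^ 2 * ρ ^ (-(d + 3)) * (12 * ν₁) ^ (d + 1) /
        (ν₁ * (ρ ^ (-(d + 1)) - 1)) * L := by
    rw [h1]; field_simp
  rw [h2, Real.mul_rpow (by positivity) hL]
  unfold constC₂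
  ring

theorem rpow_log_le {x y d : ℝ} (hx : 0 ≤ x) (hy : 1 / 2 ≤ y) (hd : 0 ≤ d) :
    (x + y) ^ (1 / (d + 2)) ≤ (1 + x) * y ^ (1 / (d + 2)) := by
  have hd2 : 0 < d + 2 := by linarith
  have h1 : x + y ≤ (1 + x) ^ (d + 2) * y := by
    -- The square suffices: (1 + x)² y ≥ y + 2xy ≥ y + x because y ≥ 1/2.
    have h2 : (1 + x) ^ (2 : ℝ) ≤ (1 + x) ^ (d + 2) :=
      Real.rpow_le_rpow_of_exponent_le (by linarith) (by linarith)
    rw [Real.rpow_two] at h2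
    nlinarith [mul_nonneg hx (sq_nonneg x)]
  calc (x + y) ^ (1 / (d + 2)) ≤ ((1 + x) ^ (d + 2) * y) ^ (1 / (d + 2)) :=
        Real.rpow_le_rpow (by linarith) h1 (by positivity)
    _ = (1 + x) * y ^ (1 / (d + 2)) := by
        rw [Real.mul_rpow (by positivity) (by linarith), ← Real.rpow_mul (by linarith),
          mul_one_div_cancel hd2.ne', Real.rpow_one]

theorem rpow_le_five_fourths_mul {x y d : ℝ} (hx : 0 ≤ x) (hxy : x ≤ 5 / 4 * y) (hd : 0 ≤ d) :
    x ^ (1 / (d + 2)) ≤ 5 / 4 * y ^ (1 / (d + 2)) := by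
  have hy : 0 ≤ y := by linarith
  calc x ^ (1 / (d + 2)) ≤ (5 / 4 * y) ^ (1 / (d + 2)) :=
        Real.rpow_le_rpow hx hxy (by positivity)
    _ = (5 / 4) ^ (1 / (d + 2)) * y ^ (1 / (d + 2)) := Real.mul_rpow (by norm_num) hy
    _ ≤ 5 / 4 * y ^ (1 / (d + 2)) := by
        gcongr
        conv_rhs => rw [← Real.rpow_one (5 / 4 : ℝ)]
        refine Real.rpow_le_rpow_of_exponent_le (by norm_num) ?_
        rw [div_le_one (by linarith)]
        linarith

/-! ### The expected regret -/

section Objective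

variable {X Ω : Type*} [MeasurableSpace Ω] {μ : Measure Ω} [IsProbabilityMeasure μ] {M : ℕ}
  {floc : Fin M → X → ℝ} {R : Fin M → ℕ → X → Ω → ℝ} (hR : RewardModel μ floc R)
include hR

theorem RewardModel.floc_mem_Icc (m : Fin M) (x : X) : floc m x ∈ Set.Icc (0 : ℝ) 1 := by
  rw [← hR.mean m 0 x]
  have hRint : Integrable (R m 0 x) μ :=
    Integrable.of_mem_Icc 0 1 (hR.measurable m 0 x).aemeasurable (hR.mem_Icc m 0 x)
  constructor
  · exact integral_nonneg_of_ae ((hR.mem_Icc m 0 x).mono fun ω h => h.1)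
  · calc ∫ ω, R m 0 x ω ∂μ ≤ ∫ _, (1 : ℝ) ∂μ :=
          integral_mono_ae hRint (integrable_const _) ((hR.mem_Icc m 0 x).mono fun ω h => h.2)
      _ = 1 := by simp

theorem RewardModel.globalObjective_mem_Icc (x : X) :
    globalObjective floc x ∈ Set.Icc (0 : ℝ) 1 := by
  refine ⟨div_nonneg (Finset.sum_nonneg fun m _ => (hR.floc_mem_Icc m x).1) (Nat.cast_nonneg _), ?_⟩
  refine div_le_one_of_le₀ ?_ (Nat.cast_nonneg _)
  calc ∑ m, floc m x ≤ ∑ _m : Fin M, (1 : ℝ) :=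
        Finset.sum_le_sum fun m _ => (hR.floc_mem_Icc m x).2
    _ = M := by simp

theorem RewardModel.le_optimum (x : X) :
    globalObjective floc x ≤ optimum (globalObjective floc) :=
  le_ciSup ⟨1, by rintro _ ⟨y, rfl⟩; exact (hR.globalObjective_mem_Icc y).2⟩ x

theorem RewardModel.optimum_sub_le_one (x : X) :
    optimum (globalObjective floc) - globalObjective floc x ≤ 1 := by
  have : Nonempty X := ⟨x⟩
  have h1 : optimum (globalObjective floc) ≤ 1 :=
    ciSup_le fun y => (hR.globalObjective_mem_Icc y).2
  have h2 := (hR.globalObjective_mem_Icc x).1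
  linarith

end Objective

section Expectation

variable {X Ω : Type*} [MeasurableSpace Ω] {μ : Measure Ω} [IsProbabilityMeasure μ]
  {a : Params} (ha : a.Admissible) (P : HierarchicalPartition X a.k)
  {floc : Fin a.M → X → ℝ} {R : Fin a.M → ℕ → X → Ω → ℝ} (hR : RewardModel μ floc R)
include hR

theorem regret_nonneg (r : Fin a.M → ℕ → X → ℝ) : 0 ≤ regret a P r (globalObjective floc) :=
  Finset.sum_nonneg fun _ _ => Finset.sum_nonneg fun _ _ => sub_nonneg.2 (hR.le_optimum _)

theorem regret_le_mul (r : Fin a.M → ℕ → X → ℝ) :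
    regret a P r (globalObjective floc) ≤ a.M * a.T := by
  calc regret a P r (globalObjective floc)
      ≤ ∑ _m : Fin a.M, ∑ _t ∈ Finset.range a.T, (1 : ℝ) :=
        Finset.sum_le_sum fun _ _ => Finset.sum_le_sum fun _ _ => hR.optimum_sub_le_one _
    _ = a.M * a.T := by simp

include ha

omit [IsProbabilityMeasure μ] in
theorem measurable_regret_rewards :
    Measurable fun ω => regret a P (fun m t x => R m t x ω) (globalObjective floc) :=
  (measurable_regret P ha (globalObjective floc)).comp (measurable_pi_iff.2 fun m =>
    measurable_pi_iff.2 fun t => measurable_pi_iff.2 fun x => hR.measurable m t x)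

theorem integrable_regret :
    Integrable (fun ω => regret a P (fun m t x => R m t x ω) (globalObjective floc)) μ :=
  Integrable.of_mem_Icc 0 (a.M * a.T) (measurable_regret_rewards ha P hR).aemeasurable
    (Filter.Eventually.of_forall fun _ => ⟨regret_nonneg P hR _, regret_le_mul P hR _⟩)

theorem integral_regret_le_mul :
    ∫ ω, regret a P (fun m t x => R m t x ω) (globalObjective floc) ∂μ ≤ a.M * a.T := by
  refine (integral_mono (integrable_regret ha P hR) (integrable_const (a.M * a.T : ℝ))
    fun _ => regret_le_mul P hR _).trans_eq ?_
  simp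

/-- The expected regret exceeds a bound that holds for accurate estimates by at most `1`. -/
theorem integral_regret_le_add_one
    (hprob : (a.M : ℝ) * a.T ^ 3 * (2 * Real.exp (-2 * (a.c ^ 2 * logTerm a))) ≤ 1)
    {G : ℝ} (hG : 0 ≤ G)
    (hacc : ∀ r, Accurate a P (globalObjective floc) r → regret a P r (globalObjective floc) ≤ G) :
    ∫ ω, regret a P (fun m t x => R m t x ω) (globalObjective floc) ∂μ ≤ G + 1 := by
  set Reg : Ω → ℝ := fun ω => regret a P (fun m t x => R m t x ω) (globalObjective floc) with hReg
  have hmeas : Measurable Reg := measurable_regret_rewards ha P hR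
  -- The event that the regret exceeds G replaces the failure of accuracy containing it: its
  -- measurability follows from that of the regret.
  have hB : MeasurableSet {ω | G < Reg ω} := measurableSet_lt measurable_const hmeas
  set ε := 2 * Real.exp (-2 * (a.c ^ 2 * logTerm a)) with hε
  have hε0 : 0 ≤ ε := by positivity
  have hBle : μ.real {ω | G < Reg ω} ≤ a.T * (a.T * ε) := by
    refine ENNReal.toReal_le_of_le_ofReal (by positivity) ?_
    rw [ENNReal.ofReal_mul (by positivity), ENNReal.ofReal_mul (by positivity),
      ENNReal.ofReal_natCast]
    refine le_trans (measure_mono fun ω hω => ?_) (measure_not_accurate_le ha P hR)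
    exact fun hcon => absurd (hacc _ hcon) (not_le.2 hω)
  have hpt : ∀ ω, Reg ω ≤ G + {ω | G < Reg ω}.indicator (fun _ => (a.M * a.T : ℝ)) ω := by
    intro ω
    by_cases h : G < Reg ω
    · rw [Set.indicator_of_mem (by exact h)]
      have := regret_le_mul P hR (fun m t x => R m t x ω)
      change Reg ω ≤ _ at this
      linarith
    · rw [Set.indicator_of_notMem (by exact h)]
      linarith
  have hind : Integrable ({ω | G < Reg ω}.indicator fun _ => (a.M * a.T : ℝ)) μ :=
    (integrable_const _).indicator hB
  calc ∫ ω, Reg ω ∂μ ≤ ∫ ω, (G + {ω | G < Reg ω}.indicator (fun _ => (a.M * a.T : ℝ)) ω) ∂μ :=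
        integral_mono (integrable_regret ha P hR) ((integrable_const G).add hind) hpt
    _ = G + μ.real {ω | G < Reg ω} * (a.M * a.T) := by
        rw [integral_add (integrable_const G) hind, integral_indicator_const _ hB]
        simp
    _ ≤ G + a.T * (a.T * ε) * (a.M * a.T) := by gcongr
    _ = G + a.M * a.T ^ 3 * ε := by ring
    _ ≤ G + 1 := by linarith

end Expectation

/-! ### Numerical bounds on the confidence level, the constants and the rate -/

theorem confidence_bound {M T : ℕ} (hM : 1 ≤ M) (hT : 1 ≤ T) {c c₁ L : ℝ} (hc : 2 ≤ c)
    (hc₁ : (2 * (M : ℝ)) ^ (1 / 8 : ℝ) ≤ c₁) (hL : 0 < L) (hLexp : Real.exp L = c₁ * (M * T)) :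
    (M : ℝ) * T ^ 3 * (2 * Real.exp (-2 * (c ^ 2 * L))) ≤ 1 := by
  have hM' : (1 : ℝ) ≤ M := by exact_mod_cast hM
  have hT' : (1 : ℝ) ≤ T := by exact_mod_cast hT
  -- As c ≥ 2, the exponential is at most (c₁MT)^(-8). The eighth power turns the condition on c₁
  -- into the factor 2M.
  have h8 : 2 * (M : ℝ) ≤ c₁ ^ 8 := by
    calc 2 * (M : ℝ) = ((2 * (M : ℝ)) ^ (1 / 8 : ℝ)) ^ 8 := by
          rw [← Real.rpow_natCast, ← Real.rpow_mul (by positivity)]; norm_num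
      _ ≤ c₁ ^ 8 := by gcongr
  have hexp : Real.exp (-2 * (c ^ 2 * L)) ≤ (Real.exp L ^ 8)⁻¹ := by
    rw [← Real.exp_nat_mul, ← Real.exp_neg]
    refine Real.exp_le_exp.2 ?_
    push_cast
    nlinarith [mul_nonneg (mul_nonneg (sub_nonneg.2 hc) (by linarith : 0 ≤ c + 2)) hL.le]
  have h9 : 2 * (M * T ^ 3 : ℝ) ≤ Real.exp L ^ 8 := by
    have h1 : (T : ℝ) ^ 3 ≤ T ^ 8 := pow_le_pow_right₀ hT' (by norm_num)
    have h2 : (1 : ℝ) ≤ M ^ 8 := one_le_pow₀ hM'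
    have h3 : (T : ℝ) ^ 3 ≤ (M * T) ^ 8 := by
      rw [mul_pow]; nlinarith [pow_pos (by linarith : (0 : ℝ) < T) 8]
    calc 2 * (M * T ^ 3 : ℝ) = 2 * M * T ^ 3 := by ring
      _ ≤ c₁ ^ 8 * (M * T) ^ 8 := by gcongr
      _ = Real.exp L ^ 8 := by rw [hLexp, mul_pow c₁]
  have hpos : 0 < Real.exp L ^ 8 := by positivity
  calc (M : ℝ) * T ^ 3 * (2 * Real.exp (-2 * (c ^ 2 * L)))
      ≤ M * T ^ 3 * (2 * (Real.exp L ^ 8)⁻¹) := by gcongr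
    _ = 2 * (M * T ^ 3) / Real.exp L ^ 8 := by ring
    _ ≤ 1 := (div_le_one hpos).2 h9

/-- The root is always near-optimal, so the count at depth 0 is at least 1. -/
theorem NearOptimalityDimension.one_le {X : Type*} {k : ℕ} {P : HierarchicalPartition X k}
    {ℓ : X → X → ℝ} {f : X → ℝ} {ν₁ ρ C d : ℝ} (hν₁ : 0 < ν₁)
    (hs : LocalSmoothness P ℓ f ν₁ ρ) (hdim : NearOptimalityDimension P f ν₁ ρ C d) : 1 ≤ C := by
  have h1 := hdim 0
  have h2 := (isOptimalNode_root (f := f) P).regret_le hs (by simp) (P.rep_mem 0 0 (by simp))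
  have h3 : 0 ∈ nearOptimalNodes P f 0 (6 * ν₁ * ρ ^ 0) := by
    refine Finset.mem_filter.2 ⟨by simp, ?_⟩
    simp only [pow_zero, mul_one] at h2 ⊢
    linarith
  have h4 : (1 : ℝ) ≤ (nearOptimalNodes P f 0 (6 * ν₁ * ρ ^ 0)).card := by
    exact_mod_cast Finset.card_pos.2 ⟨0, h3⟩
  simp only [pow_zero, Real.one_rpow, mul_one] at h1 h4
  linarith

theorem constC₂_nonneg {k : ℕ} {ν₁ ρ c C d : ℝ} (hν₁ : 0 < ν₁) (hρ₀ : 0 < ρ) (hρ₁ : ρ < 1)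
    (hC : 0 < C) (hd : 0 ≤ d) : 0 ≤ constC₂ k ν₁ ρ c C d := by
  have hq1 : 1 < ρ ^ (-(d + 1)) :=
    Real.one_lt_rpow_of_pos_of_lt_one_of_neg hρ₀ hρ₁ (by linarith)
  have hq1' : 0 < ρ ^ (-(d + 1)) - 1 := by linarith
  unfold constC₂
  positivity

theorem two_le_constC₂ {k : ℕ} {ν₁ ρ c C d : ℝ} (hk : 2 ≤ k) (hν₁ : 1 ≤ ν₁) (hρ₀ : 0 < ρ)
    (hρ₁ : ρ < 1) (hc : 2 ≤ c) (hC : 1 ≤ C) (hd : 0 ≤ d) : 2 ≤ constC₂ k ν₁ ρ c C d := by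
  have hq1 : 1 < ρ ^ (-(d + 1)) :=
    Real.one_lt_rpow_of_pos_of_lt_one_of_neg hρ₀ hρ₁ (by linarith)
  have hq1' : 0 < ρ ^ (-(d + 1)) - 1 := by linarith
  have hk' : (2 : ℝ) ≤ k := by exact_mod_cast hk
  unfold constC₂
  have h1 : ρ ^ (-(d + 1)) ≤ ρ ^ (-(d + 3)) :=
    Real.rpow_le_rpow_of_exponent_ge hρ₀ hρ₁.le (by linarith)
  have h2 : ν₁ ≤ (12 * ν₁) ^ (d + 1) := by
    calc ν₁ ≤ (12 * ν₁) ^ (1 : ℝ) := by rw [Real.rpow_one]; linarith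
      _ ≤ (12 * ν₁) ^ (d + 1) :=
          Real.rpow_le_rpow_of_exponent_le (by linarith) (by linarith)
  have h3 : 1 ≤ 24 * k * C * c ^ 2 * ρ ^ (-(d + 3)) * (12 * ν₁) ^ (d + 1)
      / (ν₁ * (ρ ^ (-(d + 1)) - 1)) := by
    rw [one_le_div (by positivity)]
    have h4 : 1 ≤ 24 * k * C * c ^ 2 := by
      have : 1 ≤ c ^ 2 := by nlinarith
      have : 1 ≤ k * C := by nlinarith
      nlinarith
    calc ν₁ * (ρ ^ (-(d + 1)) - 1) ≤ (12 * ν₁) ^ (d + 1) * ρ ^ (-(d + 3)) :=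
          mul_le_mul h2 (by linarith) hq1'.le (by positivity)
      _ = 1 * (ρ ^ (-(d + 3)) * (12 * ν₁) ^ (d + 1)) := by ring
      _ ≤ 24 * k * C * c ^ 2 * (ρ ^ (-(d + 3)) * (12 * ν₁) ^ (d + 1)) := by gcongr
      _ = _ := by ring
  have h5 := Real.one_le_rpow h3 (show 0 ≤ 1 / (d + 2) by positivity)
  linarith

theorem half_le_regretRate {d : ℝ} (hd : 0 ≤ d) : 1 / 2 ≤ regretRate 1 2 d := by
  have hlog : 1 / 2 ≤ Real.log 2 := by have := Real.log_two_gt_d9; linarith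
  have h1 : (1 : ℝ) ≤ 2 ^ ((d + 1) / (d + 2)) := Real.one_le_rpow (by norm_num) (by positivity)
  have h2 : Real.log 2 ≤ Real.log 2 ^ (1 / (d + 2)) := by
    conv_lhs => rw [← Real.rpow_one (Real.log 2)]
    refine Real.rpow_le_rpow_of_exponent_ge (by linarith) ?_ ?_
    · have := Real.log_two_lt_d9; linarith
    · rw [div_le_one (by linarith)]; linarith
  unfold regretRate
  push_cast
  rw [Real.one_rpow, one_mul, one_mul]
  nlinarith

theorem regretRate_nonneg {M T : ℕ} (hM : 1 ≤ M) (hT : 1 ≤ T) (d : ℝ) : 0 ≤ regretRate M T d := by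
  have hM' : (1 : ℝ) ≤ M := by exact_mod_cast hM
  have hT' : (1 : ℝ) ≤ T := by exact_mod_cast hT
  have := Real.log_nonneg (by nlinarith : (1 : ℝ) ≤ M * T)
  unfold regretRate
  positivity

/-- The bound on the number of nodes at the depths whose level is at most the number of clients. -/
theorem pow_le_of_level_le {a : Params} (ha : a.Admissible) (hL : 1 ≤ logTerm a) (h : ℕ)
    (hl : level a h ≤ a.M) :
    (a.k : ℝ) ^ h ≤ (a.M * (a.ν₁ ^ 2 / a.c ^ 2)) ^ (-(1 / (2 * Real.logb a.k a.ρ))) := by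
  have hc := ha.c_pos; have hν := ha.ν₁_pos; have hρ := ha.ρ_pos
  refine pow_le_rpow_of_inv_pow_le ha.two_le_k hρ ha.ρ_lt_one h ?_
  have h1 : a.c ^ 2 / a.ν₁ ^ 2 * (a.ρ ^ (2 * h))⁻¹ ≤ a.M := by
    refine le_trans ?_ hl
    unfold level
    have : a.c ^ 2 * 1 / a.ν₁ ^ 2 ≤ a.c ^ 2 * logTerm a / a.ν₁ ^ 2 := by gcongr
    rw [mul_one] at this
    gcongr
  calc (a.ρ ^ (2 * h))⁻¹ = a.c ^ 2 / a.ν₁ ^ 2 * (a.ρ ^ (2 * h))⁻¹ * (a.ν₁ ^ 2 / a.c ^ 2) := by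
        field_simp
    _ ≤ _ := by gcongr

/-! ### Assembly of the expected regret bound -/

section Expectation

variable {X Ω : Type*} [MeasurableSpace Ω] {μ : Measure Ω} [IsProbabilityMeasure μ]
  {a : Params} (ha : a.Admissible) (P : HierarchicalPartition X a.k)
  {floc : Fin a.M → X → ℝ} {R : Fin a.M → ℕ → X → Ω → ℝ} (hR : RewardModel μ floc R)
include ha hR

theorem integral_regret_le_of_pow_le (hT : 1 ≤ a.T) {ℓ : X → X → ℝ}
    (hs : LocalSmoothness P ℓ (globalObjective floc) a.ν₁ a.ρ) {C d : ℝ} (hC : 0 < C) (hd : 0 ≤ d)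
    (hdim : NearOptimalityDimension P (globalObjective floc) a.ν₁ a.ρ C d)
    (hprob : (a.M : ℝ) * a.T ^ 3 * (2 * Real.exp (-2 * (a.c ^ 2 * logTerm a))) ≤ 1)
    (hQ : ∀ h, level a h ≤ a.M →
      (a.k : ℝ) ^ h ≤ (a.M * (a.ν₁ ^ 2 / a.c ^ 2)) ^ (-(1 / (2 * Real.logb a.k a.ρ)))) :
    ∫ ω, regret a P (fun m t x => R m t x ω) (globalObjective floc) ∂μ ≤
      constC₁ a.k a.ν₁ a.ρ a.c * (a.M : ℝ) ^ (1 - 1 / (2 * Real.logb a.k a.ρ)) +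
        constC₂ a.k a.ν₁ a.ρ a.c C d * logTerm a ^ (1 / (d + 2)) *
          ((a.M : ℝ) ^ ((d + 1) / (d + 2)) * (a.T : ℝ) ^ ((d + 1) / (d + 2))) := by
  have hc := ha.c_pos; have hν := ha.ν₁_pos; have hρ := ha.ρ_pos; have hρ1 := ha.ρ_lt_one
  have hL := ha.logTerm_pos; have hM := ha.M_pos
  have hk : (0 : ℝ) < a.k := by exact_mod_cast ha.k_pos
  have hk1 : (1 : ℝ) < a.k := by exact_mod_cast ha.two_le_k
  have hT' : (0 : ℝ) < a.T := by exact_mod_cast hT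
  have hρ1' : 0 < 1 - a.ρ := by linarith
  set s := -(1 / (2 * Real.logb a.k a.ρ)) with hsdef
  have hs0 : 0 ≤ s := by
    rw [hsdef, neg_nonneg]
    have := Real.logb_neg hk1 hρ hρ1
    exact div_nonpos_of_nonneg_of_nonpos zero_le_one (by linarith)
  obtain ⟨J, hJ⟩ := exists_depth_tradeoff (ρ := a.ρ) (d := d)
    (D := 24 * a.k * C * a.c ^ 2 * logTerm a / a.ν₁ * (a.ρ ^ 2)⁻¹) (W := 12 * a.ν₁)
    (N := a.M * a.T) hρ hρ1 hd (by positivity) (by positivity) (by positivity)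
  rw [constC₂_eq hν hρ hρ1 hC hd hL.le, Real.mul_rpow hM.le hT'.le] at hJ
  have hC₂ : 0 ≤ constC₂ a.k a.ν₁ a.ρ a.c C d := constC₂_nonneg hν hρ hρ1 hC hd
  have hmain := integral_regret_le_add_one ha P hR hprob
    (G := 24 * a.k * a.ν₁ / (a.ρ ^ 2 * (1 - a.ρ)) * (a.M * (a.M * (a.ν₁ ^ 2 / a.c ^ 2)) ^ s) +
      constC₂ a.k a.ν₁ a.ρ a.c C d * logTerm a ^ (1 / (d + 2)) *
        ((a.M : ℝ) ^ ((d + 1) / (d + 2)) * (a.T : ℝ) ^ ((d + 1) / (d + 2))))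
    (by positivity) fun r hr => by
      have h1 := regret_le_of_accurate ha hs hR.le_optimum hr hC hdim (by positivity) hQ J
      linarith
  have hMpow : (a.M : ℝ) ^ (1 - 1 / (2 * Real.logb a.k a.ρ)) = a.M * (a.M : ℝ) ^ s := by
    rw [sub_eq_add_neg, ← hsdef, Real.rpow_add hM, Real.rpow_one]
  have hM1 : (1 : ℝ) ≤ a.M := by exact_mod_cast ha.one_le_M
  have hone : 1 ≤ a.M * (a.M : ℝ) ^ s := by
    have := Real.one_le_rpow hM1 hs0
    nlinarith
  -- The argument yields 24 where `constC₁` has 48; its summand 1 absorbs the cost of inaccurate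
  -- estimates.
  have hC₁ : 24 * a.k * a.ν₁ / (a.ρ ^ 2 * (1 - a.ρ)) * (a.M * (a.M * (a.ν₁ ^ 2 / a.c ^ 2)) ^ s) + 1
      ≤ constC₁ a.k a.ν₁ a.ρ a.c * (a.M * (a.M : ℝ) ^ s) := by
    rw [constC₁, ← hsdef, Real.mul_rpow hM.le (by positivity), add_mul, one_mul]
    refine add_le_add ?_ hone
    rw [show a.ρ ^ 2 - a.ρ ^ 3 = a.ρ ^ 2 * (1 - a.ρ) by ring]
    have h1 : 0 ≤ 24 * a.k * a.ν₁ / (a.ρ ^ 2 * (1 - a.ρ)) *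
      (a.M * ((a.M : ℝ) ^ s * (a.ν₁ ^ 2 / a.c ^ 2) ^ s)) := by positivity
    have h2 : 48 * a.k * a.ν₁ / (a.ρ ^ 2 * (1 - a.ρ)) * (a.ν₁ ^ 2 / a.c ^ 2) ^ s *
        (a.M * (a.M : ℝ) ^ s) = 2 * (24 * a.k * a.ν₁ / (a.ρ ^ 2 * (1 - a.ρ)) *
      (a.M * ((a.M : ℝ) ^ s * (a.ν₁ ^ 2 / a.c ^ 2) ^ s))) := by ring
    linarith
  rw [hMpow]
  linarith

theorem integral_regret_le (hT : 1 ≤ a.T) {ℓ : X → X → ℝ}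
    (hs : LocalSmoothness P ℓ (globalObjective floc) a.ν₁ a.ρ) {C d : ℝ} (hC : 0 < C) (hd : 0 ≤ d)
    (hdim : NearOptimalityDimension P (globalObjective floc) a.ν₁ a.ρ C d)
    (hprob : (a.M : ℝ) * a.T ^ 3 * (2 * Real.exp (-2 * (a.c ^ 2 * logTerm a))) ≤ 1)
    (hL : Real.log (a.M * a.T) ≤ logTerm a) {Φ : ℝ} (hΦ1 : 1 ≤ Φ)
    (hΦ : 2 ≤ a.M * a.T →
      logTerm a ^ (1 / (d + 2)) ≤ Φ * Real.log (a.M * a.T) ^ (1 / (d + 2))) :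
    ∫ ω, regret a P (fun m t x => R m t x ω) (globalObjective floc) ∂μ ≤
      constC₁ a.k a.ν₁ a.ρ a.c * (a.M : ℝ) ^ (1 - 1 / (2 * Real.logb a.k a.ρ)) +
        constC₂ a.k a.ν₁ a.ρ a.c C d * Φ * regretRate a.M a.T d := by
  have hc := ha.c_pos; have hν := ha.ν₁_pos; have hρ := ha.ρ_pos; have hρ1 := ha.ρ_lt_one
  have hM := ha.M_pos
  have hk1 : (1 : ℝ) < a.k := by exact_mod_cast ha.two_le_k
  have hM1 : (1 : ℝ) ≤ a.M := by exact_mod_cast ha.one_le_M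
  have hC₂ : 0 ≤ constC₂ a.k a.ν₁ a.ρ a.c C d := constC₂_nonneg hν hρ hρ1 hC hd
  have hrate := regretRate_nonneg ha.one_le_M hT d
  have hfirst : (a.M : ℝ) ≤
      constC₁ a.k a.ν₁ a.ρ a.c * (a.M : ℝ) ^ (1 - 1 / (2 * Real.logb a.k a.ρ)) := by
    have h1 : 1 ≤ constC₁ a.k a.ν₁ a.ρ a.c := by
      have h2 : 0 < a.ρ ^ 2 - a.ρ ^ 3 := by
        rw [show a.ρ ^ 2 - a.ρ ^ 3 = a.ρ ^ 2 * (1 - a.ρ) by ring]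
        exact mul_pos (by positivity) (by linarith)
      unfold constC₁
      have : 0 ≤ 48 * a.k * a.ν₁ / (a.ρ ^ 2 - a.ρ ^ 3) *
        (a.ν₁ ^ 2 / a.c ^ 2) ^ (-(1 / (2 * Real.logb a.k a.ρ))) := by positivity
      linarith
    have h3 : (a.M : ℝ) ≤ (a.M : ℝ) ^ (1 - 1 / (2 * Real.logb a.k a.ρ)) := by
      conv_lhs => rw [← Real.rpow_one (a.M : ℝ)]
      refine Real.rpow_le_rpow_of_exponent_le hM1 ?_
      have h4 := Real.logb_neg hk1 hρ hρ1
      have h5 : 1 / (2 * Real.logb a.k a.ρ) ≤ 0 :=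
        div_nonpos_of_nonneg_of_nonpos zero_le_one (by linarith)
      linarith
    nlinarith
  have htriv := integral_regret_le_mul ha P hR
  rcases Nat.lt_or_ge 1 a.T with hT2 | hT2
  swap
  · have hT1 : (a.T : ℝ) = 1 := by exact_mod_cast le_antisymm hT2 hT
    rw [hT1, mul_one] at htriv
    have : 0 ≤ constC₂ a.k a.ν₁ a.ρ a.c C d * Φ * regretRate a.M a.T d := by positivity
    linarith
  have hMT : 2 ≤ a.M * a.T := le_trans hT2 (Nat.le_mul_of_pos_left _ ha.one_le_M)
  have hmain : (∀ h, level a h ≤ a.M →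
      (a.k : ℝ) ^ h ≤ (a.M * (a.ν₁ ^ 2 / a.c ^ 2)) ^ (-(1 / (2 * Real.logb a.k a.ρ)))) →
      ∫ ω, regret a P (fun m t x => R m t x ω) (globalObjective floc) ∂μ ≤
      constC₁ a.k a.ν₁ a.ρ a.c * (a.M : ℝ) ^ (1 - 1 / (2 * Real.logb a.k a.ρ)) +
        constC₂ a.k a.ν₁ a.ρ a.c C d * Φ * regretRate a.M a.T d := by
    intro hQ
    refine (integral_regret_le_of_pow_le ha P hR hT hs hC hd hdim hprob hQ).trans ?_
    have h1 := hΦ hMT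
    unfold regretRate
    calc _ ≤ constC₁ a.k a.ν₁ a.ρ a.c * (a.M : ℝ) ^ (1 - 1 / (2 * Real.logb a.k a.ρ)) +
          constC₂ a.k a.ν₁ a.ρ a.c C d * (Φ * Real.log (a.M * a.T) ^ (1 / (d + 2))) *
          ((a.M : ℝ) ^ ((d + 1) / (d + 2)) * (a.T : ℝ) ^ ((d + 1) / (d + 2))) := by gcongr
      _ = _ := by ring
  rcases Nat.lt_or_ge 2 (a.M * a.T) with h3 | h3
  · refine hmain (pow_le_of_level_le ha (le_trans ?_ hL))
    have h4 : (3 : ℝ) ≤ a.M * a.T := by exact_mod_cast h3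
    rw [Real.le_log_iff_exp_le (by linarith)]
    have := Real.exp_one_lt_d9
    linarith
  -- Only M = 1, T = 2 remains, where log(c₁T/δ) may be below 1. If ν₁ ≥ 1 the C₂ term is at least 1
  -- and the trivial bound MT = M + 1 suffices; if ν₁ ≤ 1 every level exceeds M and the condition on
  -- Q is vacuous.
  · have hM1' : a.M = 1 := by
      have := ha.one_le_M
      nlinarith
    have hT2' : a.T = 2 := by rw [hM1'] at h3; omega
    rcases le_total 1 a.ν₁ with hν1 | hν1
    · have h5 := two_le_constC₂ ha.two_le_k hν1 hρ hρ1 ha.two_le_c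
        (NearOptimalityDimension.one_le hν hs hdim) hd
      have h6 : 1 / 2 ≤ regretRate a.M a.T d := by
        rw [hM1', hT2']
        exact half_le_regretRate hd
      have h7 : 2 * 1 * (1 / 2) ≤ constC₂ a.k a.ν₁ a.ρ a.c C d * Φ * regretRate a.M a.T d := by
        gcongr
      have h8 : (a.M : ℝ) * a.T = a.M + 1 := by rw [hM1', hT2']; norm_num
      linarith
    · refine hmain fun h hl => absurd hl (not_le.2 ?_)
      rw [hM1', hT2'] at hL
      rw [hM1']
      push_cast at hL ⊢
      rw [one_mul] at hL
      have hlog := Real.log_two_gt_d9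
      have h8 : 1 ≤ (a.ρ ^ (2 * h))⁻¹ :=
        (one_le_inv₀ (by positivity)).2 (pow_le_one₀ hρ.le hρ1.le)
      have h9 : 1 < a.c ^ 2 * logTerm a / a.ν₁ ^ 2 := by
        rw [one_lt_div (by positivity)]
        have : 4 ≤ a.c ^ 2 := by nlinarith [ha.two_le_c]
        have : a.ν₁ ^ 2 ≤ 1 := pow_le_one₀ hν.le hν1
        nlinarith
      unfold level
      nlinarith

end Expectation

end FedPNE

theorem mainTheorem1 {X Ω : Type*} [MeasurableSpace Ω] (μ : Measure Ω) [IsProbabilityMeasure μ]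
    (k M T : ℕ) (hk : 2 ≤ k) (hM : 1 ≤ M) (hT : 1 ≤ T)
    (P : FedPNE.HierarchicalPartition X k) (ℓ : X → X → ℝ)
    (floc : Fin M → X → ℝ) (R : Fin M → ℕ → X → Ω → ℝ) (hR : FedPNE.RewardModel μ floc R)
    (ν₁ ρ : ℝ) (hν₁ : 0 < ν₁) (hρ₀ : 0 < ρ) (hρ₁ : ρ < 1)
    (hsmooth : FedPNE.LocalSmoothness P ℓ (FedPNE.globalObjective floc) ν₁ ρ)
    (C d : ℝ) (hC : 0 < C) (hd : 0 ≤ d)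
    (hdim : FedPNE.NearOptimalityDimension P (FedPNE.globalObjective floc) ν₁ ρ C d)
    (c c₁ : ℝ) (hc : 2 ≤ c) (hc₁ : (2 * (M : ℝ)) ^ (1 / 8 : ℝ) ≤ c₁) :
    let a : FedPNE.Params :=
      { k := k, M := M, T := T, ν₁ := ν₁, ρ := ρ, c := c, c₁ := c₁, δ := 1 / (M : ℝ) }
    let Reg : Ω → ℝ := fun ω =>
      FedPNE.regret a P (fun m t x => R m t x ω) (FedPNE.globalObjective floc)
    Integrable Reg μ ∧
    ∫ ω, Reg ω ∂μ ≤
      FedPNE.constC₁ k ν₁ ρ c * (M : ℝ) ^ (1 - 1 / (2 * Real.logb k ρ))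
        + FedPNE.constC₂ k ν₁ ρ c C d * (1 + Real.log c₁) * FedPNE.regretRate M T d ∧
    (c₁ = (2 * (M : ℝ)) ^ (1 / 8 : ℝ) →
      ∫ ω, Reg ω ∂μ ≤
        FedPNE.constC₁ k ν₁ ρ c * (M : ℝ) ^ (1 - 1 / (2 * Real.logb k ρ))
          + FedPNE.constC₂ k ν₁ ρ c C d * (5 / 4) * FedPNE.regretRate M T d) := by
  intro a Reg
  have hM' : (1 : ℝ) ≤ M := by exact_mod_cast hM
  have hT' : (1 : ℝ) ≤ T := by exact_mod_cast hT
  have hMT' : (1 : ℝ) ≤ M * T := by nlinarith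
  have hc₁1 : 1 < c₁ := (Real.one_lt_rpow (by linarith) (by norm_num)).trans_le hc₁
  have hlogc₁ : 0 < Real.log c₁ := Real.log_pos hc₁1
  have harg : c₁ * T / (1 / (M : ℝ)) = c₁ * (M * T) := by field_simp
  have hL : FedPNE.logTerm a = Real.log c₁ + Real.log (M * T) := by
    change Real.log (c₁ * T / (1 / (M : ℝ))) = _
    rw [harg, Real.log_mul (by linarith) (by linarith)]
  have hLexp : Real.exp (FedPNE.logTerm a) = c₁ * (M * T) := by
    change Real.exp (Real.log (c₁ * T / (1 / (M : ℝ)))) = _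
    rw [harg, Real.exp_log (by positivity)]
  have hlogMT := Real.log_nonneg hMT'
  have hLpos : 0 < FedPNE.logTerm a := by rw [hL]; linarith
  have ha : a.Admissible := ⟨hk, hM, hν₁, hρ₀, hρ₁, hc, hLpos⟩
  have hprob := FedPNE.confidence_bound hM hT hc hc₁ hLpos hLexp
  have hLge : Real.log (a.M * a.T) ≤ FedPNE.logTerm a := by
    rw [hL]; change Real.log (M * T) ≤ _; linarith
  have hlog2 : 2 ≤ M * T → Real.log 2 ≤ Real.log (M * T) := fun h =>
    Real.log_le_log (by norm_num) (by exact_mod_cast h)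
  refine ⟨FedPNE.integrable_regret ha P hR, ?_, fun hc₁eq => ?_⟩
  · refine FedPNE.integral_regret_le ha P hR hT hsmooth hC hd hdim hprob hLge (by linarith)
      fun h => ?_
    rw [hL]
    refine FedPNE.rpow_log_le hlogc₁.le ?_ hd
    have := hlog2 h
    have := Real.log_two_gt_d9
    change 1 / 2 ≤ Real.log (M * T)
    linarith
  · refine FedPNE.integral_regret_le ha P hR hT hsmooth hC hd hdim hprob hLge (by norm_num)
      fun h => ?_
    refine FedPNE.rpow_le_five_fourths_mul hLpos.le ?_ hd
    change FedPNE.logTerm a ≤ 5 / 4 * Real.log (M * T)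
    -- Here log c₁ = (log 2 + log M)/8, and both logarithms are at most log(MT): the factor is 1 +
    -- 2/8 = 5/4.
    rw [hL, hc₁eq, Real.log_rpow (by linarith), Real.log_mul (by norm_num) (by linarith)]
    have h1 := hlog2 h
    have h2 : Real.log M ≤ Real.log (M * T) :=
      Real.log_le_log (by linarith) (by nlinarith)
    linarith
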